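/- Let $1\le k\le n$ and let $\mu=(n-k+1,1^{k-1})$ be the hook shape of size $n$ and height $k$. Young diagrams are drawn in French notation (longest row at the bottom); a tableau of shape $\lambda\vdash n$ is a filling of the cells of $\lambda$ with $1,\dots,n$, each used once, and it is standard if its entries increase along rows and up columns. Write $\mathrm{Tab}(\lambda)$ and $\mathrm{SYT}(\lambda)$ for the sets of all tableaux and of all standard tableaux of shape $\lambda$. The reading word of a tableau is the concatenation of its rows, read from left to right, from top to bottom. For $S\in\mathrm{SYT}(\lambda)$ let $\mathrm{ccTab}_\mu(S)$ be the filling of $\lambda$ that has $0$ in the cells of $1,\dots,n-k+1$ and in which, for $i=n-k+1,\dots,n-1$, the label of the cell of $i+1$ is that of the cell of $i$, plus $1$ if $i+1$ is to the left of $i$ in the reading word of $S$. Let $\mathrm{ccTab}'_\mu(S)$ be the filling that has $0$ in the cells of $n-k+1,\dots,n$ and in which, for $i=n-k+1,n-k,\dots,2$, the label of the cell of $i-1$ is that of the cell of $i$, plus $1$ if $i-1$ is to the right of $i$ in the reading word of $S$. (So labels increase exactly when the cyclic search for the next letter does not wrap around.) The group $S_n$ acts on $\mathbb C[\mathbf x]=\mathbb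 C[x_1,\dots,x_n]$ by $\pi x_i=x_{\pi(i)}$ and on $\mathbb C[\mathbf x,\mathbf y]=\mathbb C[x_1,\dots,x_n,y_1,\dots,y_n]$ diagonally by $\pi x_i=x_{\pi(i)}$, $\pi y_i=y_{\pi(i)}$. For $T\in\mathrm{Tab}(\lambda)$ put $\varepsilon_T=\sum_{\tau\in C(T)}\sum_{\sigma\in R(T)}\mathrm{sgn}(\tau)\,\tau\sigma$, where $C(T)$ and $R(T)$ are the groups of permutations that preserve every column, respectively every row, of $T$, and put $$F_T^S=\varepsilon_T\Big(\prod_{b\in\lambda}x_{T(b)}^{\mathrm{ccTab}_\mu(S)(b)}\,y_{T(b)}^{\mathrm{ccTab}'_\mu(S)(b)}\Big).$$ Let $M_\lambda^S\subseteq\mathbb C[\mathbf x,\mathbf y]$ be the linear span of the $F_T^S$ with $T\in\mathrm{SYT}(\lambda)$. Let $V_\lambda\subseteq\mathbb C[\mathbf x]$ be the Specht module, that is, the span of the Specht polynomials $F_T=\prod(x_i-x_j)$, $T\in\mathrm{Tab}(\lambda)$, where the product is over all pairs $i,j$ in the same column of $T$ with $i$ above $j$. Then: 1. For every $\lambda\vdash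 n$ and every $S\in\mathrm{SYT}(\lambda)$, the subspace $M_\lambda^S$ is stable under the diagonal action of $S_n$ and is isomorphic to $V_\lambda$ as a representation of $S_n$. 2. If $S_1\in\mathrm{SYT}(\lambda)$ and $S_2\in\mathrm{SYT}(\rho)$ are distinct standard Young tableaux of size $n$ (of equal or different shapes), then $M_\lambda^{S_1}\cap M_\rho^{S_2}=0$. -/

import Mathlib

open MvPolynomial

noncomputable section

/-- A general tableau of shape `lam`: a filling of the cells of the Young diagram with the letters
`1, …, n`, each used once.  The letter `i + 1` is represented by `i : Fin n`.
A cell is a pair `(row, column)`.  Row `0` is the longest row; in the French convention it is the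
bottom row, so that a larger row index means higher up. -/
abbrev Tableau (lam : YoungDiagram) (n : ℕ) : Type := {b : ℕ × ℕ // b ∈ lam.cells} ≃ Fin n

namespace Tableau

variable {lam : YoungDiagram} {n : ℕ}

/-- The row in which the letter `i` occurs. -/
def row (T : Tableau lam n) (i : Fin n) : ℕ := (T.symm i).1.1

/-- The column in which the letter `i` occurs. -/
def col (T : Tableau lam n) (i : Fin n) : ℕ := (T.symm i).1.2

/-- Entries increase along rows (left to right) and up columns. -/
def IsStandard (T : Tableau lam n) : Prop :=
  (∀ b c, b.1.1 = c.1.1 → b.1.2 < c.1.2 → T b < T c) ∧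
    (∀ b c, b.1.2 = c.1.2 → b.1.1 < c.1.1 → T b < T c)

/-- The column permutations `C(T)`: those sending every letter to a letter of the same column. -/
def columnPerms (T : Tableau lam n) : Finset (Equiv.Perm (Fin n)) :=
  Finset.univ.filter fun τ => ∀ i, T.col (τ i) = T.col i

/-- The row permutations `R(T)`: those sending every letter to a letter of the same row. -/
def rowPerms (T : Tableau lam n) : Finset (Equiv.Perm (Fin n)) :=
  Finset.univ.filter fun σ => ∀ i, T.row (σ i) = T.row i

/-- `ε_T = ∑_{τ ∈ C(T)} ∑_{σ ∈ R(T)} sgn(τ) τ σ` in the group algebra of `S_n`. -/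
def youngIdempotent (T : Tableau lam n) : MonoidAlgebra ℂ (Equiv.Perm (Fin n)) :=
  ∑ τ ∈ T.columnPerms, ∑ σ ∈ T.rowPerms,
    MonoidAlgebra.single (τ * σ) (((Equiv.Perm.sign τ : ℤ) : ℂ))

/-- The letter `a` (counted from `0`) occurs before the letter `b` in the reading word of `S`, which
is obtained by concatenating the rows, read from left to right, from the top row to the bottom
row. -/
def Precedes (S : Tableau lam n) (a b : ℕ) : Prop :=
  ∃ (ha : a < n) (hb : b < n),
    S.row ⟨b, hb⟩ < S.row ⟨a, ha⟩ ∨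
      (S.row ⟨a, ha⟩ = S.row ⟨b, hb⟩ ∧ S.col ⟨a, ha⟩ < S.col ⟨b, hb⟩)

open Classical in
/-- Cocharge label of the letter `m + t`.  The letter `m` has label `0`; one then searches leftwards
cyclically in the reading word for `m + 1, m + 2, …`.  The search for the next letter does not wrap
around exactly when that letter lies to the left of the current one, and then the label goes up
by one. -/
def cochargeUp (S : Tableau lam n) (m : ℕ) : ℕ → ℕ
  | 0 => 0
  | t + 1 => cochargeUp S m t + if S.Precedes (m + t + 1) (m + t) then 1 else 0

open Classical in
/-- Reverse cocharge label of the letter `m - t` (for `t ≤ m`).  The letter `m` has label `0`; one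
then searches rightwards cyclically in the reading word for `m - 1, m - 2, …`.  The search for the
next letter does not wrap around exactly when that letter lies to the right of the current one, and
then the label goes up by one. -/
def cochargeDown (S : Tableau lam n) (m : ℕ) : ℕ → ℕ
  | 0 => 0
  | t + 1 => cochargeDown S m t + if S.Precedes (m - t) (m - (t + 1)) then 1 else 0

/-- The `μ`-cocharge tableau of `S` for the hook `μ = (n - k + 1, 1^(k-1))`.  The letter `n - k + 1`
is the element `n - k` of `Fin n`; the cells of this letter and of all smaller letters
carry `0`. -/
def ccTab (k : ℕ) (S : Tableau lam n) (b : {b : ℕ × ℕ // b ∈ lam.cells}) : ℕ :=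
  S.cochargeUp (n - k) ((S b : ℕ) - (n - k))

/-- The reverse `μ`-cocharge tableau of `S` for the hook `μ = (n - k + 1, 1^(k-1))`; the cells of
the letter `n - k + 1` and of all larger letters carry `0`. -/
def ccTab' (k : ℕ) (S : Tableau lam n) (b : {b : ℕ × ℕ // b ∈ lam.cells}) : ℕ :=
  S.cochargeDown (n - k) ((n - k) - (S b : ℕ))

end Tableau

/-- Standard Young tableaux of shape `lam` with letters `1, …, n`. -/
abbrev SYT (lam : YoungDiagram) (n : ℕ) : Type := {T : Tableau lam n // T.IsStandard}

/-- The action of `S_n` on `ℂ[x_1, …, x_n]` by permuting the variables. -/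
def permRep (n : ℕ) : Representation ℂ (Equiv.Perm (Fin n)) (MvPolynomial (Fin n) ℂ) where
  toFun π := (rename π).toLinearMap
  map_one' := by
    refine LinearMap.ext fun p => ?_
    exact rename_id_apply p
  map_mul' π ρ := by
    refine LinearMap.ext fun p => ?_
    exact (rename_rename (ρ : Fin n → Fin n) (π : Fin n → Fin n) p).symm

/-- `ℂ[x_1, …, x_n, y_1, …, y_n]`; the variable `x_i` is `X (Sum.inl i)` and `y_i` is
`X (Sum.inr i)`. -/
abbrev PolyXY (n : ℕ) : Type := MvPolynomial (Fin n ⊕ Fin n) ℂ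

/-- The diagonal action of `S_n` on `ℂ[x, y]`: `π x_i = x_{π i}` and `π y_i = y_{π i}`. -/
def diagonalRep (n : ℕ) : Representation ℂ (Equiv.Perm (Fin n)) (PolyXY n) where
  toFun π := (rename (Sum.map π π)).toLinearMap
  map_one' := by
    refine LinearMap.ext fun p => ?_
    simp
  map_mul' π ρ := by
    refine LinearMap.ext fun p => ?_
    have h := rename_rename (Sum.map ρ ρ) (Sum.map π π) p
    rw [Sum.map_comp_map] at h
    exact h.symm

/-- The Specht polynomial `F_T`: the product of `x_i - x_j` over all pairs of letters `i`, `j` in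
the same column of `T` with `i` above `j`. -/
def spechtPoly {lam : YoungDiagram} {n : ℕ} (T : Tableau lam n) : MvPolynomial (Fin n) ℂ :=
  ∏ p ∈ (Finset.univ : Finset (Fin n × Fin n)).filter
      (fun p => T.col p.1 = T.col p.2 ∧ T.row p.2 < T.row p.1),
    (X p.1 - X p.2)

theorem permRep_spechtPoly {lam : YoungDiagram} {n : ℕ} (π : Equiv.Perm (Fin n))
    (T : Tableau lam n) : permRep n π (spechtPoly T) = spechtPoly (T.trans π) := by
  change rename π (spechtPoly T) = _
  unfold spechtPoly
  rw [map_prod]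
  refine Finset.prod_equiv (π.prodCongr π) ?_ ?_
  · intro p
    simp only [Finset.mem_filter, Finset.mem_univ, true_and]
    simp [Tableau.col, Tableau.row]
  · intro p _
    simp

/-- The Specht module `V_lam`: the span of the Specht polynomials of all tableaux of shape `lam`,
with the action of `S_n` that permutes the variables. -/
def spechtModule (lam : YoungDiagram) (n : ℕ) : Subrepresentation (permRep n) where
  toSubmodule := Submodule.span ℂ (Set.range fun T : Tableau lam n => spechtPoly T)
  apply_mem_toSubmodule π v hv := by
    induction hv using Submodule.span_induction with
    | mem v h =>
      obtain ⟨T, rfl⟩ := h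
      rw [permRep_spechtPoly]
      exact Submodule.subset_span ⟨_, rfl⟩
    | zero => simp
    | add a b _ _ ha hb => rw [map_add]; exact Submodule.add_mem _ ha hb
    | smul c a _ ha => rw [map_smul]; exact Submodule.smul_mem _ c ha

/-- The `μ`-monomial of the pair `(T, S)` for the hook `μ = (n - k + 1, 1^(k-1))`. -/
def muMonomial {lam : YoungDiagram} {n : ℕ} (k : ℕ) (S T : Tableau lam n) : PolyXY n :=
  ∏ b : {b : ℕ × ℕ // b ∈ lam.cells},
    X (Sum.inl (T b)) ^ S.ccTab k b * X (Sum.inr (T b)) ^ S.ccTab' k b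

/-- `F_T^S`: the Young idempotent `ε_T` applied to the `μ`-monomial of `(T, S)`. -/
def higherSpecht {lam : YoungDiagram} {n : ℕ} (k : ℕ) (S T : Tableau lam n) : PolyXY n :=
  (diagonalRep n).asAlgebraHom T.youngIdempotent (muMonomial k S T)

/-- `M_lam^S`: the linear span of the polynomials `F_T^S` over the standard tableaux `T` of shape
`lam`. -/
def higherSpechtSpan {lam : YoungDiagram} {n : ℕ} (k : ℕ) (S : SYT lam n) :
    Submodule ℂ (PolyXY n) :=
  Submodule.span ℂ (Set.range fun T : SYT lam n => higherSpecht k S.1 T.1)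

end

/-! Let A be the group algebra and write ε_T = C_T R_T (column antisymmetrizer times row
symmetrizer). Two letters sharing a column of T and a row of πU kill C_T π R_U. Hence C_T x R_T is
always a scalar multiple of ε_T, and since A is von Neumann regular, every nonzero aε_T can be
multiplied on the left back to ε_T (`exists_mul_mul_youngIdempotent_eq`). So for any vectors m_T
with π m_T = m_{πT}, the single condition ε_T m_T ≠ 0 makes the span of all ε_U m_U a copy of Aε_T
(`nonempty_equiv_of_span_youngVector`). The monomials ∏ x_i^{row(i)} yield the Specht polynomials up
to nonzero scalars, by Vandermonde; the μ-monomials yield the F_T^S. Garnir relations show that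
standard T already span (`youngVector_mem_span_standard`).

A nonzero vector common to two such spans generates both. If it exists, nonzero products C_T x R_U
and C_U y R_T exist, and comparing sums of row indices forces equal shapes. For equal shapes one
gets F_T^{S₁} = c F_T^{S₂}. The two cocharge fillings are never both nonzero in a cell, so their
difference is one integer labelling encoding the whole monomial. It is semistandard, and a
rearrangement inequality for ∑ row·label shows that ε_T separates semistandard labels
(`IsSemistandardLabel.eq_of_eq_smul`); this also gives F_T^S ≠ 0. Finally the labels recover S,
since letters with equal labels occur in reading order (`eq_of_shiftedCocharge_eq`). -/

noncomputable section

/-! ### Character sums and regularity of the group algebra -/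

section GroupAlgebra

open MonoidAlgebra Equiv

/-- The sum `∑ h ∈ H, χ h • h` in the group algebra. -/
def twistedSum {G : Type*} [Group G] (χ : G →* ℂ) (H : Finset G) : MonoidAlgebra ℂ G :=
  ∑ h ∈ H, MonoidAlgebra.single h (χ h)

section

variable {G : Type*} [Group G] (χ : G →* ℂ) {H H' : Finset G} {g : G}

theorem twistedSum_mul_single (hg : ∀ h, h * g ∈ H ↔ h ∈ H) :
    twistedSum χ H * MonoidAlgebra.single g (χ g) = twistedSum χ H := by
  unfold twistedSum
  rw [Finset.sum_mul]
  refine Finset.sum_equiv (Equiv.mulRight g) (fun h => (hg h).symm) fun h _ => ?_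
  simp [MonoidAlgebra.single_mul_single]

theorem single_mul_twistedSum (hg : ∀ h, g * h ∈ H ↔ h ∈ H) :
    MonoidAlgebra.single g (χ g) * twistedSum χ H = twistedSum χ H := by
  unfold twistedSum
  rw [Finset.mul_sum]
  refine Finset.sum_equiv (Equiv.mulLeft g) (fun h => (hg h).symm) fun h _ => ?_
  simp [MonoidAlgebra.single_mul_single]

theorem single_mul_twistedSum_of_conj (hg : ∀ h, g * h * g⁻¹ ∈ H' ↔ h ∈ H) :
    MonoidAlgebra.single g 1 * twistedSum χ H =
      twistedSum χ H' * MonoidAlgebra.single g 1 := by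
  unfold twistedSum
  rw [Finset.mul_sum, Finset.sum_mul]
  refine Finset.sum_equiv (MulAut.conj g).toEquiv (fun h => (hg h).symm) fun h _ => ?_
  have h1 : χ (g * h * g⁻¹) = χ h := by
    rw [map_mul, map_mul, mul_right_comm, ← map_mul, mul_inv_cancel, map_one, one_mul]
  simp [MonoidAlgebra.single_mul_single, -map_mul, h1]

/-- Inserting g between the factors changes the sign of the left one and fixes the right one, so the
product equals its negative. Both the transversality criterion and the Garnir relation rest on this.
-/
theorem twistedSum_mul_eq_zero (hg : ∀ h, h * g ∈ H ↔ h ∈ H) (hχ : χ g = -1)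
    {y : MonoidAlgebra ℂ G} (hy : MonoidAlgebra.single g 1 * y = y) : twistedSum χ H * y = 0 := by
  have h1 : twistedSum χ H * y = -(twistedSum χ H * y) := by
    conv_lhs => rw [← twistedSum_mul_single χ hg, hχ, mul_assoc]
    have : MonoidAlgebra.single g (-1 : ℂ) = -MonoidAlgebra.single g 1 := by
      simp
    rw [this, neg_mul, hy, mul_neg]
  have h2 : (2 : ℂ) • (twistedSum χ H * y) = 0 := by
    rw [two_smul]; nth_rw 1 [h1]; exact neg_add_cancel _
  exact (smul_eq_zero.mp h2).resolve_left two_ne_zero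

/-- The group algebra of a finite group over `ℂ` is von Neumann regular. -/
theorem exists_mul_mul_eq_self [Finite G] (u : MonoidAlgebra ℂ G) : ∃ x, u * x * u = u := by
  have : Fintype G := Fintype.ofFinite G
  -- Maschke: the left ideal Au has a complement K. With 1 = xu + w and w in K, the element uw = u -
  -- uxu lies in both Au and K, hence vanishes.
  obtain ⟨K, hK⟩ := exists_isCompl (Submodule.span (MonoidAlgebra ℂ G) {u})
  have h1 : (1 : MonoidAlgebra ℂ G) ∈ Submodule.span (MonoidAlgebra ℂ G) {u} ⊔ K := by
    rw [hK.sup_eq_top]; trivial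
  obtain ⟨v, hv, w, hw, hvw⟩ := Submodule.mem_sup.mp h1
  obtain ⟨x, rfl⟩ := Submodule.mem_span_singleton.mp hv
  refine ⟨x, ?_⟩
  have h2 : u * w = u - u * x * u := by
    rw [eq_sub_iff_add_eq, add_comm, mul_assoc, ← smul_eq_mul (a := x), ← mul_add, hvw, mul_one]
  have h3 : u * w ∈ K := K.smul_mem u hw
  have h4 : u * w ∈ Submodule.span (MonoidAlgebra ℂ G) {u} := by
    rw [h2]
    exact Submodule.sub_mem _ (Submodule.mem_span_singleton_self u)
      (Submodule.mem_span_singleton.mpr ⟨u * x, rfl⟩)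
  have h5 : u * w = 0 := (Submodule.disjoint_def.mp hK.disjoint) _ h4 h3
  rw [h5] at h2
  exact (sub_eq_zero.mp h2.symm).symm

end

/-- The sign character with complex values. -/
def signChar (α : Type*) [Fintype α] [DecidableEq α] : Perm α →* ℂ :=
  (Int.castRingHom ℂ).toMonoidHom.comp ((Units.coeHom ℤ).comp Perm.sign)

theorem signChar_apply {α : Type*} [Fintype α] [DecidableEq α] (π : Perm α) :
    signChar α π = ((Perm.sign π : ℤ) : ℂ) := rfl

theorem signChar_swap {α : Type*} [Fintype α] [DecidableEq α] {p q : α} (h : p ≠ q) :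
    signChar α (swap p q) = -1 := by
  simp [signChar_apply, Perm.sign_swap h]

theorem signChar_mul_self {α : Type*} [Fintype α] [DecidableEq α] (π : Perm α) :
    signChar α π * signChar α π = 1 := by
  rw [signChar_apply, ← Int.cast_mul, ← Units.val_mul, Int.units_mul_self]
  simp

end GroupAlgebra

/-! ### Row and column symmetrizers of a tableau -/

namespace Tableau

open Equiv

variable {lam rho : YoungDiagram} {n : ℕ}

/-- The tableau `π T`. -/
def permute (π : Perm (Fin n)) (T : Tableau lam n) : Tableau lam n := T.trans π

@[simp] theorem row_permute (π : Perm (Fin n)) (T : Tableau lam n) (i : Fin n) :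
    row (permute π T) i = T.row (π⁻¹ i) := rfl

@[simp] theorem col_permute (π : Perm (Fin n)) (T : Tableau lam n) (i : Fin n) :
    col (permute π T) i = T.col (π⁻¹ i) := rfl

theorem exists_permute (T U : Tableau lam n) : ∃ π, U = permute π T :=
  ⟨T.symm.trans U, by ext b; simp [permute]⟩

theorem mem_columnPerms {T : Tableau lam n} {τ : Perm (Fin n)} :
    τ ∈ T.columnPerms ↔ ∀ i, T.col (τ i) = T.col i := by simp [columnPerms]

theorem mem_rowPerms {T : Tableau lam n} {σ : Perm (Fin n)} :
    σ ∈ T.rowPerms ↔ ∀ i, T.row (σ i) = T.row i := by simp [rowPerms]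

theorem mem_cells (T : Tableau lam n) (i : Fin n) : (T.row i, T.col i) ∈ lam := (T.symm i).2

theorem eq_of_row_col {T : Tableau lam n} {i j : Fin n} (hr : T.row i = T.row j)
    (hc : T.col i = T.col j) : i = j :=
  T.symm.injective (Subtype.ext (Prod.ext hr hc))

theorem exists_row_col (T : Tableau lam n) {r c : ℕ} (h : (r, c) ∈ lam) :
    ∃ i, T.row i = r ∧ T.col i = c :=
  ⟨T ⟨(r, c), h⟩, by simp [row], by simp [col]⟩

/-- `∑ τ ∈ C(T), sgn(τ) τ`. -/
def columnAntisymmetrizer (T : Tableau lam n) : MonoidAlgebra ℂ (Perm (Fin n)) :=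
  twistedSum (signChar (Fin n)) T.columnPerms

/-- `∑ σ ∈ R(T), σ`. -/
def rowSymmetrizer (T : Tableau lam n) : MonoidAlgebra ℂ (Perm (Fin n)) :=
  twistedSum 1 T.rowPerms

theorem youngIdempotent_eq (T : Tableau lam n) :
    T.youngIdempotent = T.columnAntisymmetrizer * T.rowSymmetrizer := by
  simp [youngIdempotent, columnAntisymmetrizer, rowSymmetrizer, twistedSum, Finset.sum_mul_sum,
    MonoidAlgebra.single_mul_single, signChar_apply]

theorem mul_mem_columnPerms {T : Tableau lam n} {τ : Perm (Fin n)} (hτ : τ ∈ T.columnPerms)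
    (π : Perm (Fin n)) : π * τ ∈ T.columnPerms ↔ π ∈ T.columnPerms := by
  simp only [mem_columnPerms] at *
  constructor
  · intro h i
    have := h (τ⁻¹ i)
    rw [← hτ (τ⁻¹ i)] at this
    simpa using this
  · intro h i
    simp [h, hτ]

theorem mul_mem_columnPerms' {T : Tableau lam n} {τ : Perm (Fin n)} (hτ : τ ∈ T.columnPerms)
    (π : Perm (Fin n)) : τ * π ∈ T.columnPerms ↔ π ∈ T.columnPerms := by
  simp only [mem_columnPerms] at *
  simp [hτ]

theorem mul_mem_rowPerms' {T : Tableau lam n} {τ : Perm (Fin n)} (hτ : τ ∈ T.rowPerms)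
    (π : Perm (Fin n)) : τ * π ∈ T.rowPerms ↔ π ∈ T.rowPerms := by
  simp only [mem_rowPerms] at *
  simp [hτ]

theorem swap_mem_columnPerms {T : Tableau lam n} {p q : Fin n} (h : T.col p = T.col q) :
    swap p q ∈ T.columnPerms := by
  rw [mem_columnPerms]
  intro i
  by_cases hp : i = p
  · subst hp; simp [h]
  by_cases hq : i = q
  · subst hq; simp [h]
  rw [swap_apply_of_ne_of_ne hp hq]

theorem swap_mem_rowPerms {T : Tableau lam n} {p q : Fin n} (h : T.row p = T.row q) :
    swap p q ∈ T.rowPerms := by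
  rw [mem_rowPerms]
  intro i
  by_cases hp : i = p
  · subst hp; simp [h]
  by_cases hq : i = q
  · subst hq; simp [h]
  rw [swap_apply_of_ne_of_ne hp hq]

theorem single_mul_columnAntisymmetrizer (π : Perm (Fin n)) (T : Tableau lam n) :
    MonoidAlgebra.single π 1 * T.columnAntisymmetrizer =
      (permute π T).columnAntisymmetrizer * MonoidAlgebra.single π 1 := by
  refine single_mul_twistedSum_of_conj _ fun h => ?_
  simp only [mem_columnPerms, col_permute]
  constructor
  · intro H i
    simpa using H (π i)
  · intro H i
    simp [H]

theorem single_mul_rowSymmetrizer (π : Perm (Fin n)) (T : Tableau lam n) :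
    MonoidAlgebra.single π 1 * T.rowSymmetrizer =
      (permute π T).rowSymmetrizer * MonoidAlgebra.single π 1 := by
  refine single_mul_twistedSum_of_conj _ fun h => ?_
  simp only [mem_rowPerms, row_permute]
  constructor
  · intro H i
    simpa using H (π i)
  · intro H i
    simp [H]

theorem single_mul_youngIdempotent (π : Perm (Fin n)) (T : Tableau lam n) :
    MonoidAlgebra.single π 1 * T.youngIdempotent =
      (permute π T).youngIdempotent * MonoidAlgebra.single π 1 := by
  rw [youngIdempotent_eq, youngIdempotent_eq, ← mul_assoc, single_mul_columnAntisymmetrizer,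
    mul_assoc, single_mul_rowSymmetrizer, mul_assoc]

theorem single_mul_rowSymmetrizer_of_mem {T : Tableau lam n} {σ : Perm (Fin n)}
    (h : σ ∈ T.rowPerms) : MonoidAlgebra.single σ 1 * T.rowSymmetrizer = T.rowSymmetrizer :=
  single_mul_twistedSum 1 (mul_mem_rowPerms' h)

theorem single_mul_columnAntisymmetrizer_of_mem {T : Tableau lam n} {τ : Perm (Fin n)}
    (h : τ ∈ T.columnPerms) :
    MonoidAlgebra.single τ (signChar (Fin n) τ) * T.columnAntisymmetrizer =
      T.columnAntisymmetrizer :=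
  single_mul_twistedSum _ (mul_mem_columnPerms' h)

theorem columnAntisymmetrizer_mul_single_of_mem {T : Tableau lam n} {τ : Perm (Fin n)}
    (h : τ ∈ T.columnPerms) :
    T.columnAntisymmetrizer * MonoidAlgebra.single τ (signChar (Fin n) τ) =
      T.columnAntisymmetrizer :=
  twistedSum_mul_single _ (mul_mem_columnPerms h)

/-- Every column of `T` meets every row of `U` in at most one letter. -/
def Transverse (T : Tableau lam n) (U : Tableau rho n) : Prop :=
  ∀ p q, T.col p = T.col q → U.row p = U.row q → p = q

/-- The transposition of two offending letters is odd in C(T) and is absorbed by the row symmetrizer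
of πU. -/
theorem antisymmetrizer_mul_single_mul_symmetrizer_eq_zero {T : Tableau lam n}
    {U : Tableau rho n} {π : Perm (Fin n)} (h : ¬ T.Transverse (permute π U)) :
    T.columnAntisymmetrizer * MonoidAlgebra.single π 1 * U.rowSymmetrizer = 0 := by
  simp only [Transverse, not_forall] at h
  obtain ⟨p, q, hc, hr, hpq⟩ := h
  rw [mul_assoc]
  refine twistedSum_mul_eq_zero _ (mul_mem_columnPerms (swap_mem_columnPerms hc))
    (signChar_swap hpq) ?_
  rw [single_mul_rowSymmetrizer, ← mul_assoc,
    single_mul_rowSymmetrizer_of_mem (swap_mem_rowPerms hr)]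

theorem exists_transverse {T : Tableau lam n} {U : Tableau rho n}
    {x : MonoidAlgebra ℂ (Perm (Fin n))}
    (hx : T.columnAntisymmetrizer * x * U.rowSymmetrizer ≠ 0) :
    ∃ π, T.Transverse (permute π U) := by
  by_contra! h
  apply hx
  clear hx
  induction x using MonoidAlgebra.induction_linear with
  | zero => simp
  | add x y hx hy => rw [mul_add, add_mul, hx, hy, add_zero]
  | single π c =>
    have : MonoidAlgebra.single π c = c • MonoidAlgebra.single π (1 : ℂ) := by simp
    rw [this, mul_smul_comm, smul_mul_assoc,
      antisymmetrizer_mul_single_mul_symmetrizer_eq_zero (h π), smul_zero]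

end Tableau

/-! ### Transverse tableaux and minimality of the Young idempotent -/

/-- Elements of s outside the initial segment are at least `s.card`, those it misses are smaller,
and there are equally many of each; every exchange gains at least one. The defect term settles the
equality case. -/
theorem sum_range_add_card_sdiff_le (s : Finset ℕ) :
    ∑ i ∈ Finset.range s.card, i + (Finset.range s.card \ s).card ≤ ∑ i ∈ s, i := by
  set R := Finset.range s.card with hR
  have hc : (s \ R).card = (R \ s).card := Finset.card_sdiff_comm (by simp [hR])
  have h1 : (s \ R).card • s.card ≤ ∑ i ∈ s \ R, i :=
    Finset.card_nsmul_le_sum _ _ _ fun i hi => by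
      simp only [hR, Finset.mem_sdiff, Finset.mem_range, not_lt] at hi
      exact hi.2
  have h2 : ∑ i ∈ R \ s, (i + 1) ≤ (R \ s).card • s.card :=
    Finset.sum_le_card_nsmul _ _ _ fun i hi => by
      simp only [hR, Finset.mem_sdiff, Finset.mem_range] at hi
      exact hi.1
  rw [Finset.sum_add_distrib] at h2
  simp only [Finset.sum_const, smul_eq_mul, mul_one] at h2
  have h3 := Finset.sum_inter_add_sum_sdiff s R (fun i => i)
  have h4 := Finset.sum_inter_add_sum_sdiff R s (fun i => i)
  rw [Finset.inter_comm] at h4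
  rw [hc, smul_eq_mul] at h1
  omega

namespace Tableau

open Equiv

variable {lam rho : YoungDiagram} {n : ℕ}

/-- The letters in column `j`. -/
def columnLetters (T : Tableau lam n) (j : ℕ) : Finset (Fin n) :=
  Finset.univ.filter fun i => T.col i = j

@[simp] theorem mem_columnLetters {T : Tableau lam n} {j : ℕ} {i : Fin n} :
    i ∈ T.columnLetters j ↔ T.col i = j := by simp [columnLetters]

theorem row_injOn_columnLetters (T : Tableau lam n) (j : ℕ) :
    Set.InjOn T.row (T.columnLetters j) := fun p hp q hq h => by
  simp only [Finset.mem_coe, mem_columnLetters] at hp hq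
  exact eq_of_row_col h (hp.trans hq.symm)

theorem image_row_columnLetters (T : Tableau lam n) (j : ℕ) :
    (T.columnLetters j).image T.row = Finset.range (lam.colLen j) := by
  ext r
  simp only [Finset.mem_image, mem_columnLetters, Finset.mem_range,
    ← YoungDiagram.mem_iff_lt_colLen]
  constructor
  · rintro ⟨i, rfl, rfl⟩
    exact T.mem_cells i
  · intro h
    obtain ⟨i, h1, h2⟩ := T.exists_row_col h
    exact ⟨i, h2, h1⟩

theorem card_columnLetters (T : Tableau lam n) (j : ℕ) :
    (T.columnLetters j).card = lam.colLen j := by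
  rw [← Finset.card_image_of_injOn (T.row_injOn_columnLetters j), image_row_columnLetters,
    Finset.card_range]

theorem card_filter_row (T : Tableau lam n) (r : ℕ) :
    (Finset.univ.filter fun i => T.row i = r).card = lam.rowLen r := by
  rw [YoungDiagram.rowLen_eq_card]
  refine Finset.card_bij (fun i _ => (T.row i, T.col i)) ?_ ?_ ?_
  · intro i hi
    simp only [Finset.mem_filter, Finset.mem_univ, true_and] at hi
    rw [YoungDiagram.mem_row_iff]
    exact ⟨T.mem_cells i, hi⟩
  · intro p _ q _ h
    simp only [Prod.mk.injEq] at h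
    exact eq_of_row_col h.1 h.2
  · rintro ⟨a, b⟩ h
    rw [YoungDiagram.mem_row_iff] at h
    obtain ⟨i, h1, h2⟩ := T.exists_row_col h.1
    simp only at h
    exact ⟨i, by simp [h1, h.2], by rw [h1, h2]⟩

theorem sum_eq_sum_columns (T : Tableau lam n) (f : Fin n → ℕ) :
    ∑ i, f i = ∑ j ∈ Finset.univ.image T.col, ∑ i ∈ T.columnLetters j, f i :=
  (Finset.sum_fiberwise_of_maps_to (fun i _ => Finset.mem_image_of_mem _ (Finset.mem_univ i))
    f).symm

/-- On a column of T the rows of T fill an initial segment, while the rows of U are pairwise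
distinct by transversality. -/
theorem Transverse.sum_column_le {T : Tableau lam n} {U : Tableau rho n} (h : T.Transverse U)
    (j : ℕ) :
    ∑ i ∈ T.columnLetters j, T.row i +
        (Finset.range (lam.colLen j) \ (T.columnLetters j).image U.row).card ≤
      ∑ i ∈ T.columnLetters j, U.row i := by
  have hinj : Set.InjOn U.row (T.columnLetters j) := fun p hp q hq hpq => by
    simp only [Finset.mem_coe, mem_columnLetters] at hp hq
    exact h p q (hp.trans hq.symm) hpq
  have h1 := sum_range_add_card_sdiff_le ((T.columnLetters j).image U.row)
  rw [Finset.card_image_of_injOn hinj, card_columnLetters, Finset.sum_image hinj,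
    ← image_row_columnLetters T j, Finset.sum_image (T.row_injOn_columnLetters j)] at h1
  rwa [← image_row_columnLetters T j]

theorem Transverse.sum_row_le {T : Tableau lam n} {U : Tableau rho n} (h : T.Transverse U) :
    ∑ i, T.row i ≤ ∑ i, U.row i := by
  rw [sum_eq_sum_columns T, sum_eq_sum_columns T]
  exact Finset.sum_le_sum fun j _ => le_of_add_le_left (h.sum_column_le j)

/-- Equal totals leave no defect in any column, so the U-rows of each T-column form exactly its
initial segment. Thus (U-row, T-column) is always a cell of `lam`, and by transversality no cell is
hit twice. -/
theorem Transverse.exists_mixed {T : Tableau lam n} {U : Tableau rho n} (h : T.Transverse U)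
    (hsum : ∑ i, T.row i = ∑ i, U.row i) :
    ∃ V : Tableau lam n, (∀ i, V.row i = U.row i) ∧ ∀ i, V.col i = T.col i := by
  have hmem : ∀ i, (U.row i, T.col i) ∈ lam := by
    intro i
    rw [sum_eq_sum_columns T, sum_eq_sum_columns T] at hsum
    have h1 := (Finset.sum_eq_sum_iff_of_le
      fun j _ => le_of_add_le_left (h.sum_column_le j)).mp hsum (T.col i) (by simp)
    have h2 := h.sum_column_le (T.col i)
    have h3 : (Finset.range (lam.colLen (T.col i)) \
        (T.columnLetters (T.col i)).image U.row).card = 0 := by omega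
    rw [Finset.card_eq_zero, Finset.sdiff_eq_empty_iff_subset] at h3
    have h4 := Finset.eq_of_subset_of_card_le h3 (by
      rw [Finset.card_range, ← T.card_columnLetters]
      exact Finset.card_image_le)
    rw [YoungDiagram.mem_iff_lt_colLen, ← Finset.mem_range, h4]
    exact Finset.mem_image_of_mem _ (by simp)
  let φ : Fin n → {b : ℕ × ℕ // b ∈ lam.cells} := fun i => ⟨(U.row i, T.col i), hmem i⟩
  have hφ : Function.Injective φ := fun p q hpq => by
    simp only [φ, Subtype.mk.injEq, Prod.mk.injEq] at hpq
    exact h p q hpq.2 hpq.1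
  have hb : Function.Bijective φ :=
    (Fintype.bijective_iff_injective_and_card φ).mpr ⟨hφ, (Fintype.card_congr T).symm⟩
  exact ⟨(Equiv.ofBijective φ hb).symm, fun i => rfl, fun i => rfl⟩

theorem shape_eq_of_row_eq (V : Tableau lam n) (U : Tableau rho n)
    (h : ∀ i, V.row i = U.row i) : lam = rho := by
  have h1 : ∀ r, lam.rowLen r = rho.rowLen r := fun r => by
    rw [← V.card_filter_row, ← U.card_filter_row]
    simp [h]
  refine YoungDiagram.ext (Finset.ext fun ⟨a, b⟩ => ?_)
  rw [YoungDiagram.mem_cells, YoungDiagram.mem_cells, YoungDiagram.mem_iff_lt_rowLen,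
    YoungDiagram.mem_iff_lt_rowLen, h1]

theorem sum_row_permute (π : Perm (Fin n)) (T : Tableau lam n) :
    ∑ i, row (permute π T) i = ∑ i, T.row i := by
  simp only [row_permute]
  exact Equiv.sum_comp π⁻¹ T.row

theorem shape_eq_of_transverse {T : Tableau lam n} {U : Tableau rho n} {π ρ : Perm (Fin n)}
    (h1 : T.Transverse (permute π U)) (h2 : U.Transverse (permute ρ T)) : lam = rho := by
  have h3 := h1.sum_row_le
  have h4 := h2.sum_row_le
  rw [sum_row_permute] at h4
  have h5 := sum_row_permute π U
  obtain ⟨V, hV, _⟩ := h1.exists_mixed (by omega)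
  exact shape_eq_of_row_eq V (permute π U) hV

/-- The mixed tableau is τT with τ in C(T), and it has the rows of πT, so τ⁻¹π lies in R(T). -/
theorem Transverse.exists_factorization {T : Tableau lam n} {π : Perm (Fin n)}
    (h : T.Transverse (permute π T)) :
    ∃ τ ∈ T.columnPerms, ∃ σ ∈ T.rowPerms, π = τ * σ := by
  obtain ⟨V, hr, hc⟩ := h.exists_mixed (sum_row_permute π T).symm
  obtain ⟨τ, rfl⟩ := exists_permute T V
  simp only [row_permute, col_permute] at hr hc
  refine ⟨τ, ?_, τ⁻¹ * π, ?_, by simp⟩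
  · rw [mem_columnPerms]
    intro i
    simpa using (hc (τ i)).symm
  · rw [mem_rowPerms]
    intro i
    simpa using hr (π i)

/-- By linearity x may be a permutation: a non-transverse one gives 0, and a transverse one factors
as τσ, which the two symmetrizers absorb up to sign. -/
theorem exists_antisymmetrizer_mul_mul_symmetrizer_eq (T : Tableau lam n)
    (x : MonoidAlgebra ℂ (Perm (Fin n))) :
    ∃ c : ℂ, T.columnAntisymmetrizer * x * T.rowSymmetrizer = c • T.youngIdempotent := by
  induction x using MonoidAlgebra.induction_linear with
  | zero => exact ⟨0, by simp⟩
  | add x y hx hy =>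
    obtain ⟨c, hc⟩ := hx
    obtain ⟨d, hd⟩ := hy
    exact ⟨c + d, by rw [mul_add, add_mul, hc, hd, add_smul]⟩
  | single π a =>
    have ha : MonoidAlgebra.single π a = a • MonoidAlgebra.single π (1 : ℂ) := by simp
    by_cases h : T.Transverse (permute π T)
    · obtain ⟨τ, hτ, σ, hσ, rfl⟩ := h.exists_factorization
      refine ⟨a * signChar (Fin n) τ, ?_⟩
      have h1 : MonoidAlgebra.single (τ * σ) (1 : ℂ) = signChar (Fin n) τ •
          (MonoidAlgebra.single τ (signChar (Fin n) τ) * MonoidAlgebra.single σ 1) := by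
        rw [MonoidAlgebra.single_mul_single, MonoidAlgebra.smul_single, smul_eq_mul, mul_one,
          signChar_mul_self]
      rw [ha, h1, youngIdempotent_eq, mul_smul_comm, mul_smul_comm, ← mul_assoc,
        columnAntisymmetrizer_mul_single_of_mem hτ, smul_mul_assoc, smul_mul_assoc, mul_assoc,
        single_mul_rowSymmetrizer_of_mem hσ, smul_smul]
    · refine ⟨0, ?_⟩
      rw [ha, mul_smul_comm, smul_mul_assoc,
        antisymmetrizer_mul_single_mul_symmetrizer_eq_zero h, smul_zero, zero_smul]

/-- This is minimality of the left ideal Aε_T. For u = aε_T and uxu = u, the element ε_T x u equals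
cε_T; multiplying by a gives u = cu, so c = 1. -/
theorem exists_mul_mul_youngIdempotent_eq {T : Tableau lam n}
    {a : MonoidAlgebra ℂ (Perm (Fin n))} (ha : a * T.youngIdempotent ≠ 0) :
    ∃ b, b * (a * T.youngIdempotent) = T.youngIdempotent := by
  obtain ⟨x, hx⟩ := exists_mul_mul_eq_self (a * T.youngIdempotent)
  obtain ⟨c, hc⟩ := T.exists_antisymmetrizer_mul_mul_symmetrizer_eq
    (T.rowSymmetrizer * x * a * T.columnAntisymmetrizer)
  have h1 : T.youngIdempotent * x * (a * T.youngIdempotent) = c • T.youngIdempotent := by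
    rw [← hc, youngIdempotent_eq]
    simp only [mul_assoc]
  have h2 : (1 - c) • (a * T.youngIdempotent) = 0 := by
    rw [sub_smul, one_smul, ← mul_smul_comm, ← h1, sub_eq_zero]
    nth_rw 1 [← hx]
    simp only [mul_assoc]
  have h3 : c = 1 := (sub_eq_zero.mp ((smul_eq_zero.mp h2).resolve_right ha)).symm
  exact ⟨T.youngIdempotent * x, by rw [h1, h3, one_smul]⟩

end Tableau

/-! ### Equality cases of the rearrangement inequality -/

section Rearrangement

variable {ι : Type*} [Fintype ι] [DecidableEq ι] {s : Finset ι} {σ : Equiv.Perm ι}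

/-- Comonotonicity gives ∑ g·(g∘σ) = ∑ g², hence ∑ (g∘σ - g)² = 0. -/
theorem comp_perm_eq_self_of_monovaryOn {g : ι → ℤ} (hs : ∀ i, i ∉ s → σ i = i)
    (h : MonovaryOn g (g ∘ σ) s) : ∀ i, g (σ i) = g i := by
  have hσ : {x | σ x ≠ x} ⊆ (s : Set ι) := fun x hx => by
    by_contra hxs; exact hx (hs x hxs)
  have h1 : ∑ i ∈ s, g i * g (σ i) = ∑ i ∈ s, g i * g i :=
    ((monovaryOn_self g s).sum_mul_comp_perm_eq_sum_mul_iff hσ).mpr h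
  have h2 : ∑ i, g i * g (σ i) = ∑ i, g i * g i := by
    rw [← Finset.sum_add_sum_compl s, ← Finset.sum_add_sum_compl s, h1]
    congr 1
    exact Finset.sum_congr rfl fun i hi => by rw [hs i (Finset.mem_compl.mp hi)]
  have h3 : ∑ i, g (σ i) * g (σ i) = ∑ i, g i * g i := Equiv.sum_comp σ fun i => g i * g i
  have h4 : ∑ i, (g (σ i) - g i) ^ 2 = 0 := by
    have : ∀ i, (g (σ i) - g i) ^ 2 = g (σ i) * g (σ i) - 2 * (g i * g (σ i)) + g i * g i :=
      fun i => by ring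
    simp only [this, Finset.sum_add_distrib, Finset.sum_sub_distrib, ← Finset.mul_sum, h2, h3]
    ring
  intro i
  have h5 := (Finset.sum_eq_zero_iff_of_nonneg fun i _ => sq_nonneg _).mp h4 i (Finset.mem_univ i)
  exact sub_eq_zero.mp (pow_eq_zero_iff two_ne_zero |>.mp h5)

/-- If equality held, g and g∘σ would both antivary with the injective f, hence be comonotone and
therefore equal. -/
theorem sum_mul_lt_sum_mul_comp_perm {f g : ι → ℤ} (hf : Set.InjOn f s) (h : AntivaryOn f g s)
    (hs : ∀ i, i ∉ s → σ i = i) (hne : ∃ i, g (σ i) ≠ g i) :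
    ∑ i, f i * g i < ∑ i, f i * g (σ i) := by
  have hσ : {x | σ x ≠ x} ⊆ (s : Set ι) := fun x hx => by
    by_contra hxs; exact hx (hs x hxs)
  rw [← Finset.sum_add_sum_compl s, ← Finset.sum_add_sum_compl s (fun i => f i * g (σ i))]
  refine add_lt_add_of_lt_of_le ((h.sum_mul_lt_sum_mul_comp_perm_iff hσ).mpr fun h1 => ?_)
    (Finset.sum_le_sum fun i hi => by rw [hs i (Finset.mem_compl.mp hi)])
  obtain ⟨i, hi⟩ := hne
  refine hi (comp_perm_eq_self_of_monovaryOn hs ?_ i)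
  intro a ha b hb hab
  have h2 : f b < f a := lt_of_le_of_ne (h1 ha hb hab) fun he => by
    rw [hf hb ha he] at hab
    exact lt_irrefl _ hab
  by_contra! h3
  exact absurd (h hb ha h3) (not_le.mpr h2)

end Rearrangement

/-! ### Garnir relations and straightening -/

namespace Tableau

open Equiv

variable {lam : YoungDiagram} {n : ℕ}

/-- The permutations of the letters in `X`, with all other letters fixed. -/
def permsOn (X : Finset (Fin n)) : Finset (Perm (Fin n)) :=
  Finset.univ.filter fun π => ∀ i, i ∉ X → π i = i

@[simp] theorem mem_permsOn {X : Finset (Fin n)} {π : Perm (Fin n)} :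
    π ∈ permsOn X ↔ ∀ i, i ∉ X → π i = i := by simp [permsOn]

theorem mul_swap_mem_permsOn {X : Finset (Fin n)} {p q : Fin n} (hp : p ∈ X) (hq : q ∈ X)
    (π : Perm (Fin n)) : π * swap p q ∈ permsOn X ↔ π ∈ permsOn X := by
  have h : ∀ i, i ∉ X → swap p q i = i := fun i hi =>
    swap_apply_of_ne_of_ne (fun h => hi (h ▸ hp)) fun h => hi (h ▸ hq)
  simp only [mem_permsOn, Perm.mul_apply]
  exact forall₂_congr fun i hi => by rw [h i hi]

/-- The Garnir relation. -/
theorem twistedSum_permsOn_mul_youngIdempotent {T : Tableau lam n} {X : Finset (Fin n)}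
    (h : ∀ τ ∈ T.columnPerms, ∃ p ∈ X, ∃ q ∈ X, p ≠ q ∧
      row (permute τ T) p = row (permute τ T) q) :
    twistedSum (signChar (Fin n)) (permsOn X) * T.youngIdempotent = 0 := by
  rw [youngIdempotent_eq, columnAntisymmetrizer]
  nth_rw 2 [twistedSum]
  rw [Finset.sum_mul, Finset.mul_sum]
  refine Finset.sum_eq_zero fun τ hτ => ?_
  obtain ⟨p, hp, q, hq, hpq, hr⟩ := h τ hτ
  have h1 : MonoidAlgebra.single τ (signChar (Fin n) τ) =
      signChar (Fin n) τ • MonoidAlgebra.single τ (1 : ℂ) := by simp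
  rw [h1, smul_mul_assoc, mul_smul_comm, single_mul_rowSymmetrizer,
    twistedSum_mul_eq_zero _ (mul_swap_mem_permsOn hp hq) (signChar_swap hpq), smul_zero]
  rw [← mul_assoc, single_mul_rowSymmetrizer_of_mem (swap_mem_rowPerms hr)]

/-- The letters involved in the Garnir relation of columns `j`, `k` at row `a`. -/
def garnirLetters (T : Tableau lam n) (a j k : ℕ) : Finset (Fin n) :=
  Finset.univ.filter fun i => (T.col i = j ∧ a ≤ T.row i) ∨ (T.col i = k ∧ T.row i ≤ a)

/-- Row a contributes a letter from each of the two columns; this extra letter drives the pigeonhole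
argument. -/
theorem card_garnirLetters {T : Tableau lam n} {a j k : ℕ} (hjk : j < k) (h : (a, k) ∈ lam) :
    (T.garnirLetters a j k).card = lam.colLen j + 1 := by
  have hk : a < lam.colLen k := YoungDiagram.mem_iff_lt_colLen.mp h
  have hj : a < lam.colLen j := hk.trans_le (lam.colLen_anti j k hjk.le)
  have h1 : (Finset.univ.filter fun i => T.col i = j ∧ a ≤ T.row i).image T.row =
      Finset.Ico a (lam.colLen j) := by
    ext b
    simp only [Finset.mem_image, Finset.mem_filter, Finset.mem_univ, true_and, Finset.mem_Ico]
    constructor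
    · rintro ⟨i, ⟨rfl, h2⟩, rfl⟩
      exact ⟨h2, YoungDiagram.mem_iff_lt_colLen.mp (T.mem_cells i)⟩
    · rintro ⟨h2, h3⟩
      obtain ⟨i, h4, h5⟩ := T.exists_row_col (YoungDiagram.mem_iff_lt_colLen.mpr h3)
      exact ⟨i, ⟨h5, by omega⟩, h4⟩
  have h2 : (Finset.univ.filter fun i => T.col i = k ∧ T.row i ≤ a).image T.row =
      Finset.range (a + 1) := by
    ext b
    simp only [Finset.mem_image, Finset.mem_filter, Finset.mem_univ, true_and, Finset.mem_range]
    constructor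
    · rintro ⟨i, ⟨rfl, h2⟩, rfl⟩
      omega
    · intro h3
      obtain ⟨i, h4, h5⟩ := T.exists_row_col
        (YoungDiagram.mem_iff_lt_colLen.mpr (by omega : b < lam.colLen k))
      exact ⟨i, ⟨h5, by omega⟩, h4⟩
  have h3 := Finset.card_image_of_injOn
    (s := Finset.univ.filter fun i => T.col i = j ∧ a ≤ T.row i) (f := T.row)
    fun p hp q hq hpq => by
      simp only [Finset.coe_filter, Finset.mem_univ, true_and, Set.mem_ofPred_eq] at hp hq
      exact eq_of_row_col hpq (hp.1.trans hq.1.symm)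
  have h4 := Finset.card_image_of_injOn
    (s := Finset.univ.filter fun i => T.col i = k ∧ T.row i ≤ a) (f := T.row)
    fun p hp q hq hpq => by
      simp only [Finset.coe_filter, Finset.mem_univ, true_and, Set.mem_ofPred_eq] at hp hq
      exact eq_of_row_col hpq (hp.1.trans hq.1.symm)
  rw [h1, Nat.card_Ico] at h3
  rw [h2, Finset.card_range] at h4
  rw [garnirLetters, Finset.filter_or, Finset.card_union_of_disjoint, ← h3, ← h4]
  · omega
  · rw [Finset.disjoint_filter]
    rintro i _ ⟨rfl, _⟩ ⟨rfl, _⟩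
    exact lt_irrefl _ hjk

/-- In τT these letters still lie in columns j and k, which have at most `lam.colLen j` rows: one
fewer than there are letters. -/
theorem exists_row_eq_of_garnirLetters {T : Tableau lam n} {a j k : ℕ} (hjk : j < k)
    (h : (a, k) ∈ lam) {τ : Perm (Fin n)} (hτ : τ ∈ T.columnPerms) :
    ∃ p ∈ T.garnirLetters a j k, ∃ q ∈ T.garnirLetters a j k, p ≠ q ∧
      row (permute τ T) p = row (permute τ T) q := by
  refine Finset.exists_ne_map_eq_of_card_lt_of_maps_to (t := Finset.range (lam.colLen j)) ?_ ?_
  · rw [card_garnirLetters hjk h, Finset.card_range]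
    exact Nat.lt_succ_self _
  · intro i hi
    simp only [garnirLetters, Finset.coe_filter, Finset.mem_univ, true_and,
      Set.mem_ofPred_eq] at hi
    have h1 := mem_cells (permute τ T) i
    have h2 : T.col (τ⁻¹ i) = T.col i := by
      have := mem_columnPerms.mp hτ (τ⁻¹ i)
      simpa using this.symm
    rw [YoungDiagram.mem_iff_lt_colLen, col_permute, h2] at h1
    have h3 : lam.colLen (T.col i) ≤ lam.colLen j := lam.colLen_anti _ _ (by omega)
    simpa using h1.trans_le h3

theorem inv_mem_columnPerms {T : Tableau lam n} {τ : Perm (Fin n)} (hτ : τ ∈ T.columnPerms) :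
    τ⁻¹ ∈ T.columnPerms := by
  rw [mem_columnPerms] at *
  intro i
  simpa using (hτ (τ⁻¹ i)).symm

/-- The sum of letters weighted by their columns. -/
def columnWeight (T : Tableau lam n) : ℤ := ∑ i : Fin n, ((i : ℕ) : ℤ) * (T.col i : ℤ)

/-- The sum of letters weighted by their rows. -/
def rowWeight (T : Tableau lam n) : ℤ := ∑ i : Fin n, ((i : ℕ) : ℤ) * (T.row i : ℤ)

theorem columnWeight_permute_of_mem {T : Tableau lam n} {τ : Perm (Fin n)}
    (hτ : τ ∈ T.columnPerms) : columnWeight (permute τ T) = T.columnWeight := by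
  unfold columnWeight
  simp only [col_permute, mem_columnPerms.mp (inv_mem_columnPerms hτ)]

theorem rowWeight_lt_permute_swap {T : Tableau lam n} {p q : Fin n} (hqp : q < p)
    (hr : T.row p < T.row q) : T.rowWeight < rowWeight (permute (swap p q) T) := by
  unfold rowWeight
  simp only [row_permute]
  refine sum_mul_lt_sum_mul_comp_perm (f := fun i : Fin n => ((i : ℕ) : ℤ))
    (g := fun i => (T.row i : ℤ)) (s := {p, q}) ?_ ?_ ?_ ?_
  · intro a _ b _ hab
    exact Fin.ext (by simpa using hab)
  · intro a ha b hb hab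
    simp only [Finset.coe_insert, Finset.coe_singleton, Set.mem_insert_iff,
      Set.mem_singleton_iff, Nat.cast_lt] at ha hb hab
    rcases ha with rfl | rfl <;> rcases hb with rfl | rfl
    · exact le_rfl
    · simpa using hqp.le
    · omega
    · exact le_rfl
  · intro i hi
    simp only [Finset.mem_insert, Finset.mem_singleton, not_or] at hi
    rw [swap_inv, swap_apply_of_ne_of_ne hi.1 hi.2]
  · exact ⟨p, by rw [swap_inv, swap_apply_left]; simpa using hr.ne'⟩

/-- By `hX` the letters in the left column exceed those in the right one, so the present arrangement
minimizes ∑ letter·column over permutations of these letters, and only column permutations keep the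
minimum. -/
theorem columnWeight_lt_permute {T : Tableau lam n} {a j k : ℕ} (hjk : j < k)
    (hX : ∀ p ∈ T.garnirLetters a j k, ∀ q ∈ T.garnirLetters a j k,
      T.col p = j → T.col q = k → q ≤ p)
    {π : Perm (Fin n)} (hπ : π ∈ permsOn (T.garnirLetters a j k)) (hC : π ∉ T.columnPerms) :
    T.columnWeight < columnWeight (permute π T) := by
  unfold columnWeight
  simp only [col_permute]
  have hcol : ∀ p ∈ T.garnirLetters a j k, T.col p = j ∨ T.col p = k := fun p hp => by
    simp only [garnirLetters, Finset.mem_filter, Finset.mem_univ, true_and] at hp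
    omega
  refine sum_mul_lt_sum_mul_comp_perm (f := fun i : Fin n => ((i : ℕ) : ℤ))
    (g := fun i => (T.col i : ℤ)) (s := T.garnirLetters a j k) ?_ ?_ ?_ ?_
  · intro a _ b _ hab
    exact Fin.ext (by simpa using hab)
  · intro p hp q hq hpq
    simp only [Nat.cast_lt] at hpq
    have h1 := hcol p hp
    have h2 := hcol q hq
    have h3 := hX p hp q hq (by omega) (by omega)
    simpa using h3
  · intro i hi
    have := mem_permsOn.mp hπ i hi
    rw [Perm.inv_eq_iff_eq, this]
  · by_contra! h
    refine hC ?_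
    rw [← inv_inv π]
    exact inv_mem_columnPerms (mem_columnPerms.mpr fun i => by simpa using h i)

section Representation

variable {V : Type*} [AddCommGroup V] [Module ℂ V] (r : Representation ℂ (Perm (Fin n)) V)
  (m : Tableau lam n → V)

/-- The Young idempotent of `T` applied to the vector attached to `T`. -/
def youngVector (T : Tableau lam n) : V := r.asAlgebraHom T.youngIdempotent (m T)

variable {r m}

theorem apply_youngVector (hm : ∀ π T, r π (m T) = m (permute π T)) (π : Perm (Fin n)) (T : Tableau lam n) :
    r π (youngVector r m T) = youngVector r m (permute π T) := by
  unfold youngVector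
  rw [← hm, ← Representation.asAlgebraHom_single_one r π, ← Module.End.mul_apply,
    ← Module.End.mul_apply, ← map_mul, ← map_mul, single_mul_youngIdempotent]

theorem youngVector_permute_of_mem (hm : ∀ π T, r π (m T) = m (permute π T))
    {τ : Perm (Fin n)} {T : Tableau lam n} (hτ : τ ∈ T.columnPerms) :
    youngVector r m (permute τ T) = signChar (Fin n) τ • youngVector r m T := by
  have h1 : MonoidAlgebra.single τ (1 : ℂ) * T.youngIdempotent =
      signChar (Fin n) τ • T.youngIdempotent := by
    have h2 : MonoidAlgebra.single τ (1 : ℂ) =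
        signChar (Fin n) τ • MonoidAlgebra.single τ (signChar (Fin n) τ) := by
      rw [MonoidAlgebra.smul_single, smul_eq_mul, signChar_mul_self]
    rw [youngIdempotent_eq, ← mul_assoc, h2, smul_mul_assoc,
      single_mul_columnAntisymmetrizer_of_mem hτ, smul_mul_assoc]
  rw [← apply_youngVector hm, youngVector, ← Representation.asAlgebraHom_single_one r τ,
    ← Module.End.mul_apply, ← map_mul, h1, map_smul, LinearMap.smul_apply]

theorem sum_permsOn_youngVector (hm : ∀ π T, r π (m T) = m (permute π T))
    {T : Tableau lam n} {X : Finset (Fin n)}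
    (h : ∀ τ ∈ T.columnPerms, ∃ p ∈ X, ∃ q ∈ X, p ≠ q ∧
      row (permute τ T) p = row (permute τ T) q) :
    ∑ π ∈ permsOn X, signChar (Fin n) π • youngVector r m (permute π T) = 0 := by
  have h1 : r.asAlgebraHom (twistedSum (signChar (Fin n)) (permsOn X)) (youngVector r m T) = 0 := by
    rw [youngVector, ← Module.End.mul_apply, ← map_mul, twistedSum_permsOn_mul_youngIdempotent h,
      map_zero, LinearMap.zero_apply]
  rw [← h1, twistedSum, map_sum, LinearMap.sum_apply]
  refine Finset.sum_congr rfl fun π _ => ?_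
  rw [Representation.asAlgebraHom_single, LinearMap.smul_apply, apply_youngVector hm]

/-- A counterexample maximal for (`columnWeight`, `rowWeight`) in lexicographic order must be
standard. A descent in a column is removed by a swap, which costs only a sign and raises the row
weight. At a descent in a row, the Garnir relation expresses a positive multiple of the vector
through vectors of larger column weight. -/
theorem youngVector_mem_span_standard (hm : ∀ π T, r π (m T) = m (permute π T))
    (T : Tableau lam n) :
    youngVector r m T ∈ Submodule.span ℂ (Set.range fun T : SYT lam n => youngVector r m T.1) := by
  set W := Submodule.span ℂ (Set.range fun T : SYT lam n => youngVector r m T.1) with hW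
  by_contra hT
  obtain ⟨T, hT, hmax⟩ := Set.Finite.exists_maximalFor
    (fun T : Tableau lam n => toLex (T.columnWeight, T.rowWeight))
    {T | youngVector r m T ∉ W} (Set.toFinite _) ⟨T, hT⟩
  have hup : ∀ U : Tableau lam n,
      toLex (T.columnWeight, T.rowWeight) < toLex (U.columnWeight, U.rowWeight) →
      youngVector r m U ∈ W := fun U hU => by
    by_contra h
    exact absurd (hmax h hU.le) (not_le.mpr hU)
  have hcolumn : ∀ p q, T.col p = T.col q → T.row p < T.row q → p < q := by
    intro p q hc hr
    by_contra! hqp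
    have hlt : q < p := lt_of_le_of_ne hqp fun h => by rw [h] at hr; exact lt_irrefl _ hr
    have hmem := swap_mem_columnPerms hc
    have h1 := hup (permute (swap p q) T) (by
      rw [Prod.Lex.toLex_lt_toLex]
      exact Or.inr ⟨(columnWeight_permute_of_mem hmem).symm, rowWeight_lt_permute_swap hlt hr⟩)
    rw [youngVector_permute_of_mem hm hmem, signChar_swap hlt.ne', neg_smul, one_smul,
      neg_mem_iff] at h1
    exact hT h1
  have hrow : ∀ p q, T.row p = T.row q → T.col p < T.col q → p < q := by
    intro p q hr hc
    by_contra! hqp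
    have hmem : (T.row p, T.col q) ∈ lam := hr ▸ T.mem_cells q
    have h0 := sum_permsOn_youngVector hm (X := T.garnirLetters (T.row p) (T.col p) (T.col q))
      fun τ hτ => exists_row_eq_of_garnirLetters hc hmem hτ
    have hmono : ∀ i j, T.col i = T.col j → T.row i ≤ T.row j → i ≤ j := fun i j h1 h2 => by
      rcases h2.lt_or_eq with h3 | h3
      · exact (hcolumn i j h1 h3).le
      · exact (eq_of_row_col h3 h1).le
    rw [← Finset.sum_filter_add_sum_filter_not _ fun π => π ∈ T.columnPerms] at h0
    have h1 : ∑ π ∈ (permsOn (T.garnirLetters (T.row p) (T.col p) (T.col q))).filter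
        (fun π => ¬ π ∈ T.columnPerms),
        signChar (Fin n) π • youngVector r m (permute π T) ∈ W := by
      refine Submodule.sum_mem _ fun π hπ => Submodule.smul_mem _ _ (hup _ ?_)
      rw [Finset.mem_filter] at hπ
      rw [Prod.Lex.toLex_lt_toLex]
      refine Or.inl (columnWeight_lt_permute hc ?_ hπ.1 hπ.2)
      intro i hi j hj hi' hj'
      simp only [garnirLetters, Finset.mem_filter, Finset.mem_univ, true_and] at hi hj
      -- Columns already increase, so the single descent q ≤ p spreads to all Garnir letters: j ≤ q
      -- ≤ p ≤ i.
      exact (hmono j q hj' (by omega)).trans (hqp.trans (hmono p i hi'.symm (by omega)))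
    have h2 : ∀ π ∈ (permsOn (T.garnirLetters (T.row p) (T.col p) (T.col q))).filter
        (fun π => π ∈ T.columnPerms),
        signChar (Fin n) π • youngVector r m (permute π T) = youngVector r m T := by
      intro π hπ
      rw [youngVector_permute_of_mem hm (Finset.mem_filter.mp hπ).2, smul_smul,
        signChar_mul_self, one_smul]
    rw [Finset.sum_congr rfl h2, Finset.sum_const, add_eq_zero_iff_eq_neg,
      ← Nat.cast_smul_eq_nsmul ℂ] at h0
    have h3 := (Submodule.smul_mem_iff W ?_).mp (h0 ▸ W.neg_mem h1)
    · exact hT h3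
    -- The identity is among the column-preserving terms, so their number is nonzero and can be
    -- cancelled over ℂ.
    · rw [Nat.cast_ne_zero]
      exact Finset.card_ne_zero.mpr ⟨1, Finset.mem_filter.mpr
        ⟨mem_permsOn.mpr fun i _ => rfl, mem_columnPerms.mpr fun i => rfl⟩⟩
  refine hT (Submodule.subset_span ⟨⟨T, fun b c h1 h2 => hrow _ _ ?_ ?_,
    fun b c h1 h2 => hcolumn _ _ ?_ ?_⟩, rfl⟩)
  all_goals simpa [row, col]

theorem span_standard_eq (hm : ∀ π T, r π (m T) = m (permute π T)) :
    Submodule.span ℂ (Set.range fun T : SYT lam n => youngVector r m T.1) =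
      Submodule.span ℂ (Set.range (youngVector (lam := lam) r m)) := by
  refine le_antisymm (Submodule.span_mono ?_) (Submodule.span_le.mpr ?_)
  · rintro _ ⟨T, rfl⟩
    exact ⟨T.1, rfl⟩
  · rintro _ ⟨T, rfl⟩
    exact youngVector_mem_span_standard hm T

end Representation

end Tableau

/-! ### Modules generated by Young vectors -/

namespace Tableau

open Equiv

variable {lam rho : YoungDiagram} {n : ℕ}

section

variable {V V' : Type*} [AddCommGroup V] [Module ℂ V] [AddCommGroup V'] [Module ℂ V']
  {r : Representation ℂ (Perm (Fin n)) V} {r' : Representation ℂ (Perm (Fin n)) V'}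
  {m : Tableau lam n → V} {m' : Tableau lam n → V'}

theorem asAlgebraHom_youngVector (a : MonoidAlgebra ℂ (Perm (Fin n))) (T : Tableau lam n) :
    r.asAlgebraHom a (youngVector r m T) = r.asAlgebraHom (a * T.youngIdempotent) (m T) := by
  rw [youngVector, ← Module.End.mul_apply, ← map_mul]

/-- The orbit map `a ↦ a F_T` of the group algebra. -/
def youngOrbit (r : Representation ℂ (Perm (Fin n)) V) (m : Tableau lam n → V)
    (T : Tableau lam n) : MonoidAlgebra ℂ (Perm (Fin n)) →ₗ[ℂ] V :=
  (LinearMap.applyₗ (youngVector r m T)).comp r.asAlgebraHom.toLinearMap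

theorem youngOrbit_apply (T : Tableau lam n) (a : MonoidAlgebra ℂ (Perm (Fin n))) :
    youngOrbit r m T a = r.asAlgebraHom a (youngVector r m T) := rfl

theorem youngOrbit_single_mul (T : Tableau lam n) (π : Perm (Fin n))
    (a : MonoidAlgebra ℂ (Perm (Fin n))) :
    youngOrbit r m T (MonoidAlgebra.single π 1 * a) = r π (youngOrbit r m T a) := by
  rw [youngOrbit_apply, map_mul, Representation.asAlgebraHom_single_one]
  rfl

theorem range_youngOrbit (hm : ∀ π T, r π (m T) = m (permute π T)) (T : Tableau lam n) :
    LinearMap.range (youngOrbit r m T) = Submodule.span ℂ (Set.range (youngVector r m)) := by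
  apply le_antisymm
  · rintro _ ⟨a, rfl⟩
    rw [youngOrbit_apply]
    induction a using MonoidAlgebra.induction_linear with
    | zero => simp
    | add x y hx hy => rw [map_add]; exact Submodule.add_mem _ hx hy
    | single π c =>
      rw [Representation.asAlgebraHom_single, LinearMap.smul_apply, apply_youngVector hm]
      exact Submodule.smul_mem _ _ (Submodule.subset_span ⟨_, rfl⟩)
  · rw [Submodule.span_le]
    rintro _ ⟨U, rfl⟩
    obtain ⟨π, rfl⟩ := exists_permute T U
    refine ⟨MonoidAlgebra.single π 1, ?_⟩
    rw [youngOrbit_apply, Representation.asAlgebraHom_single_one, apply_youngVector hm]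

/-- If aε_T ≠ 0, some b restores ε_T from it, so killing the vector by a would make the vector
itself zero. The kernel is thus independent of the representation. -/
theorem ker_youngOrbit {T : Tableau lam n} (h : youngVector r m T ≠ 0)
    (a : MonoidAlgebra ℂ (Perm (Fin n))) :
    youngOrbit r m T a = 0 ↔ a * T.youngIdempotent = 0 := by
  rw [youngOrbit_apply, asAlgebraHom_youngVector]
  constructor
  · intro h0
    by_contra hne
    obtain ⟨b, hb⟩ := exists_mul_mul_youngIdempotent_eq hne
    apply h
    rw [youngVector, ← hb, map_mul, Module.End.mul_apply, h0, map_zero]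
  · intro h0
    rw [h0, map_zero, LinearMap.zero_apply]

theorem nonempty_equiv_of_span_youngVector (hm : ∀ π T, r π (m T) = m (permute π T))
    (hm' : ∀ π T, r' π (m' T) = m' (permute π T)) {T : Tableau lam n}
    (h : youngVector r m T ≠ 0) (h' : youngVector r' m' T ≠ 0)
    {M : Subrepresentation r} {M' : Subrepresentation r'}
    (hM : M.toSubmodule = Submodule.span ℂ (Set.range (youngVector r m)))
    (hM' : M'.toSubmodule = Submodule.span ℂ (Set.range (youngVector r' m'))) :
    Nonempty (Representation.Equiv M.toRepresentation M'.toRepresentation) := by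
  have hker : LinearMap.ker (youngOrbit r m T) = LinearMap.ker (youngOrbit r' m' T) := by
    ext a
    rw [LinearMap.mem_ker, LinearMap.mem_ker, ker_youngOrbit h, ker_youngOrbit h']
  let q := (youngOrbit r m T).quotKerEquivRange
  let q' := (youngOrbit r' m' T).quotKerEquivRange
  let e : M.toSubmodule ≃ₗ[ℂ] M'.toSubmodule :=
    (LinearEquiv.ofEq _ _ (hM.trans (range_youngOrbit hm T).symm)) ≪≫ₗ
      q.symm ≪≫ₗ (Submodule.quotEquivOfEq _ _ hker) ≪≫ₗ q' ≪≫ₗ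
      (LinearEquiv.ofEq _ _ ((range_youngOrbit hm' T).trans hM'.symm))
  have he : ∀ (v : M.toSubmodule) (a : MonoidAlgebra ℂ (Perm (Fin n))),
      (v : V) = youngOrbit r m T a → ((e v : M'.toSubmodule) : V') = youngOrbit r' m' T a := by
    intro v a hv
    have h1 : LinearEquiv.ofEq _ _ (hM.trans (range_youngOrbit hm T).symm) v =
        q (Submodule.Quotient.mk a) := Subtype.ext hv
    simp only [e, LinearEquiv.trans_apply, h1, LinearEquiv.symm_apply_apply,
      Submodule.quotEquivOfEq_mk]
    rfl
  refine ⟨Representation.Equiv.mk e fun π => LinearMap.ext fun v => Subtype.ext ?_⟩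
  obtain ⟨a, ha⟩ : ∃ a, youngOrbit r m T a = v := by
    rw [← LinearMap.mem_range, range_youngOrbit hm, ← hM]
    exact v.2
  have h2 : ((M.toRepresentation π v : M.toSubmodule) : V) =
      youngOrbit r m T (MonoidAlgebra.single π 1 * a) := by
    rw [youngOrbit_single_mul, ha]
    rfl
  have h3 : ((M'.toRepresentation π (e v) : M'.toSubmodule) : V') = r' π (e v) := rfl
  change ((e (M.toRepresentation π v) : M'.toSubmodule) : V') =
    ((M'.toRepresentation π (e v) : M'.toSubmodule) : V')
  rw [he _ _ h2, h3, he _ _ ha.symm, youngOrbit_single_mul]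

end

section

variable {V : Type*} [AddCommGroup V] [Module ℂ V]
  {r : Representation ℂ (Perm (Fin n)) V} {m : Tableau lam n → V} {m' : Tableau rho n → V}

/-- Writing v = aε_T m_T = bε_U m'_U, minimality gives d with daε_T = ε_T, so d recovers the first
generator from v. -/
theorem exists_youngVector_eq (hm : ∀ π T, r π (m T) = m (permute π T))
    (hm' : ∀ π T, r π (m' T) = m' (permute π T)) {v : V} (hv : v ≠ 0)
    (h : v ∈ Submodule.span ℂ (Set.range (youngVector r m)))
    (h' : v ∈ Submodule.span ℂ (Set.range (youngVector r m')))
    (T : Tableau lam n) (U : Tableau rho n) :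
    ∃ x, youngVector r m T =
      r.asAlgebraHom (T.columnAntisymmetrizer * x * U.rowSymmetrizer) (m' U) := by
  rw [← range_youngOrbit hm T] at h
  rw [← range_youngOrbit hm' U] at h'
  obtain ⟨a, rfl⟩ := h
  obtain ⟨b, hb⟩ := h'
  rw [youngOrbit_apply, youngOrbit_apply, asAlgebraHom_youngVector,
    asAlgebraHom_youngVector] at hb
  rw [youngOrbit_apply, asAlgebraHom_youngVector] at hv
  have hne : a * T.youngIdempotent ≠ 0 := fun h0 => hv (by rw [h0, map_zero, LinearMap.zero_apply])
  obtain ⟨d, hd⟩ := exists_mul_mul_youngIdempotent_eq hne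
  -- Rewriting ε_T as ε_T z ε_T puts the column antisymmetrizer of T in front of the final
  -- expression.
  obtain ⟨z, hz⟩ := exists_mul_mul_eq_self T.youngIdempotent
  refine ⟨T.rowSymmetrizer * z * d * b * U.columnAntisymmetrizer, ?_⟩
  have h1 : T.columnAntisymmetrizer *
      (T.rowSymmetrizer * z * d * b * U.columnAntisymmetrizer) * U.rowSymmetrizer =
      (T.youngIdempotent * z * d) * (b * U.youngIdempotent) := by
    simp only [youngIdempotent_eq, mul_assoc]
  rw [h1, map_mul, Module.End.mul_apply, hb, ← Module.End.mul_apply, ← map_mul, mul_assoc _ d,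
    hd, hz, youngVector]

theorem shape_eq_of_mem_spans (hm : ∀ π T, r π (m T) = m (permute π T))
    (hm' : ∀ π T, r π (m' T) = m' (permute π T)) {v : V} (hv : v ≠ 0)
    (h : v ∈ Submodule.span ℂ (Set.range (youngVector r m)))
    (h' : v ∈ Submodule.span ℂ (Set.range (youngVector r m')))
    {T : Tableau lam n} {U : Tableau rho n} (hT : youngVector r m T ≠ 0)
    (hU : youngVector r m' U ≠ 0) : lam = rho := by
  obtain ⟨x, hx⟩ := exists_youngVector_eq hm hm' hv h h' T U
  obtain ⟨y, hy⟩ := exists_youngVector_eq hm' hm hv h' h U T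
  obtain ⟨π, hπ⟩ := exists_transverse (T := T) (U := U) (x := x) fun h0 => hT (by
    rw [hx, h0, map_zero, LinearMap.zero_apply])
  obtain ⟨ρ, hρ⟩ := exists_transverse (T := U) (U := T) (x := y) fun h0 => hU (by
    rw [hy, h0, map_zero, LinearMap.zero_apply])
  exact shape_eq_of_transverse hπ hρ

theorem exists_youngVector_eq_smul {m' : Tableau lam n → V}
    (hm : ∀ π T, r π (m T) = m (permute π T))
    (hm' : ∀ π T, r π (m' T) = m' (permute π T)) {v : V} (hv : v ≠ 0)
    (h : v ∈ Submodule.span ℂ (Set.range (youngVector r m)))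
    (h' : v ∈ Submodule.span ℂ (Set.range (youngVector r m'))) (T : Tableau lam n) :
    ∃ c : ℂ, youngVector r m T = c • youngVector r m' T := by
  obtain ⟨x, hx⟩ := exists_youngVector_eq hm hm' hv h h' T T
  obtain ⟨c, hc⟩ := T.exists_antisymmetrizer_mul_mul_symmetrizer_eq x
  exact ⟨c, by rw [hx, hc, map_smul, LinearMap.smul_apply, youngVector]⟩

end

end Tableau

/-! ### Specht polynomials as Young vectors -/

namespace Tableau

open Equiv

variable {lam : YoungDiagram} {n : ℕ}

/-- The monomial `∏ x_i ^ row(i)`. -/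
def rowMonomial (T : Tableau lam n) : MvPolynomial (Fin n) ℂ := ∏ i, X i ^ T.row i

theorem permRep_apply (π : Perm (Fin n)) (p : MvPolynomial (Fin n) ℂ) :
    permRep n π p = rename π p := rfl

theorem permRep_rowMonomial (π : Perm (Fin n)) (T : Tableau lam n) :
    permRep n π T.rowMonomial = rowMonomial (permute π T) := by
  rw [permRep_apply, rowMonomial, rowMonomial, map_prod,
    ← Equiv.prod_comp π fun i => X i ^ row (permute π T) i]
  simp

/-- The letters of column `j`, ordered by their rows. -/
def columnEquiv (T : Tableau lam n) (j : ℕ) : Fin (lam.colLen j) ≃ {i // T.col i = j} :=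
  Equiv.ofBijective
    (fun a => ⟨T ⟨(a, j), YoungDiagram.mem_iff_lt_colLen.mpr a.2⟩, by simp [col]⟩) <| by
      constructor
      · intro a b hab
        simpa [Fin.ext_iff] using hab
      · rintro ⟨i, rfl⟩
        refine ⟨⟨T.row i, YoungDiagram.mem_iff_lt_colLen.mp (T.mem_cells i)⟩, Subtype.ext ?_⟩
        exact T.apply_symm_apply i

@[simp] theorem row_columnEquiv (T : Tableau lam n) (j : ℕ) (a : Fin (lam.colLen j)) :
    T.row (T.columnEquiv j a) = a := by
  change (T.symm (T ⟨(a, j), _⟩)).1.1 = _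
  rw [Equiv.symm_apply_apply]

/-- The block diagonal matrix whose blocks are the Vandermonde matrices of the columns. -/
def columnMatrix (T : Tableau lam n) : Matrix (Fin n) (Fin n) (MvPolynomial (Fin n) ℂ) :=
  Matrix.of fun i j => if T.col i = T.col j then X i ^ T.row j else 0

/-- Grouped by columns the matrix is block diagonal, and ordering each column by rows turns its
block into a Vandermonde matrix. -/
theorem det_columnMatrix (T : Tableau lam n) : T.columnMatrix.det = spechtPoly T := by
  have hbt : T.columnMatrix.BlockTriangular T.col := fun i j hij => by
    rw [columnMatrix, Matrix.of_apply, if_neg hij.ne']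
  rw [hbt.det, spechtPoly, ← Finset.prod_fiberwise_of_maps_to
    (g := fun p : Fin n × Fin n => T.col p.1) (t := Finset.univ.image T.col)
    (fun p _ => Finset.mem_image_of_mem _ (Finset.mem_univ p.1))]
  refine Finset.prod_congr rfl fun j _ => ?_
  have h1 : (T.columnMatrix.toSquareBlock T.col j).submatrix (T.columnEquiv j)
      (T.columnEquiv j) = Matrix.vandermonde fun a => X ((T.columnEquiv j a : Fin n)) := by
    ext1 a b
    simp only [Matrix.submatrix_apply, Matrix.toSquareBlock_def, Matrix.of_apply, columnMatrix,
      Matrix.vandermonde_apply, row_columnEquiv]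
    rw [if_pos ((T.columnEquiv j a).2.trans (T.columnEquiv j b).2.symm)]
  rw [← Matrix.det_submatrix_equiv_self (T.columnEquiv j), h1, Matrix.det_vandermonde,
    Finset.prod_sigma']
  -- The Vandermonde factor for a < b is v b - v a, so the upper letter comes first, as in
  -- `spechtPoly`.
  refine Finset.prod_bij
    (fun x _ => ((T.columnEquiv j x.2 : Fin n), (T.columnEquiv j x.1 : Fin n))) ?_ ?_ ?_ ?_
  · rintro ⟨a, b⟩ hab
    simp only [Finset.mem_sigma, Finset.mem_univ, Finset.mem_Ioi, true_and] at hab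
    simpa [(T.columnEquiv j a).2, (T.columnEquiv j b).2] using hab
  · rintro ⟨a, b⟩ _ ⟨c, d⟩ _ h
    simp only [Prod.mk.injEq] at h
    rw [(T.columnEquiv j).injective (Subtype.ext h.1),
      (T.columnEquiv j).injective (Subtype.ext h.2)]
  · rintro ⟨p, q⟩ h
    simp only [Finset.mem_filter, Finset.mem_univ, true_and] at h
    obtain ⟨⟨h1, h2⟩, h3⟩ := h
    obtain ⟨a, ha⟩ := (T.columnEquiv j).surjective ⟨q, h1.symm.trans h3⟩
    obtain ⟨b, hb⟩ := (T.columnEquiv j).surjective ⟨p, h3⟩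
    refine ⟨⟨a, b⟩, ?_, by simp [ha, hb]⟩
    simp only [Finset.mem_sigma, Finset.mem_univ, Finset.mem_Ioi, true_and]
    rw [Fin.lt_def, ← T.row_columnEquiv j a, ← T.row_columnEquiv j b, ha, hb]
    exact h2
  · intro x _
    rfl

/-- In the Leibniz expansion of the determinant, permutations outside C(T) meet a zero entry; the
others give the signed translates of the row monomial. -/
theorem asAlgebraHom_columnAntisymmetrizer (T : Tableau lam n) :
    (permRep n).asAlgebraHom T.columnAntisymmetrizer T.rowMonomial = spechtPoly T := by
  rw [← det_columnMatrix, Matrix.det_apply, columnAntisymmetrizer, twistedSum, map_sum,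
    LinearMap.sum_apply]
  rw [← Finset.sum_filter_add_sum_filter_not Finset.univ (fun τ => ∀ i, T.col (τ i) = T.col i)]
  rw [Finset.sum_eq_zero (s := Finset.univ.filter fun τ : Perm (Fin n) =>
    ¬ ∀ i, T.col (τ i) = T.col i), add_zero]
  · refine Finset.sum_congr rfl fun τ hτ => ?_
    rw [Representation.asAlgebraHom_single, LinearMap.smul_apply, permRep_apply, rowMonomial,
      map_prod, signChar_apply, Units.smul_def, Int.cast_smul_eq_zsmul]
    congr 1
    refine Finset.prod_congr rfl fun i _ => ?_
    rw [columnMatrix, Matrix.of_apply, if_pos (mem_columnPerms.mp hτ i), map_pow, rename_X]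
  · intro τ hτ
    simp only [Finset.mem_filter, Finset.mem_univ, true_and, not_forall] at hτ
    obtain ⟨i, hi⟩ := hτ
    rw [Finset.prod_eq_zero (Finset.mem_univ i), smul_zero]
    rw [columnMatrix, Matrix.of_apply, if_neg hi]

theorem youngVector_rowMonomial (T : Tableau lam n) :
    youngVector (permRep n) rowMonomial T = (T.rowPerms.card : ℂ) • spechtPoly T := by
  rw [youngVector, youngIdempotent_eq, map_mul, Module.End.mul_apply]
  have h1 : (permRep n).asAlgebraHom T.rowSymmetrizer T.rowMonomial =
      (T.rowPerms.card : ℂ) • T.rowMonomial := by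
    rw [rowSymmetrizer, twistedSum, map_sum, LinearMap.sum_apply, Nat.cast_smul_eq_nsmul,
      ← Finset.sum_const]
    refine Finset.sum_congr rfl fun σ hσ => ?_
    rw [MonoidHom.one_apply, Representation.asAlgebraHom_single_one, permRep_rowMonomial]
    refine Finset.prod_congr rfl fun i _ => ?_
    have h2 := mem_rowPerms.mp hσ (σ⁻¹ i)
    have h3 : row (permute σ T) i = T.row i := by simpa using h2.symm
    rw [h3]
  rw [h1, map_smul, asAlgebraHom_columnAntisymmetrizer]

theorem card_rowPerms_ne_zero (T : Tableau lam n) : (T.rowPerms.card : ℂ) ≠ 0 :=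
  Nat.cast_ne_zero.mpr (Finset.card_ne_zero.mpr ⟨1, mem_rowPerms.mpr fun _ => rfl⟩)

theorem spechtPoly_ne_zero (T : Tableau lam n) : spechtPoly T ≠ 0 := by
  rw [spechtPoly, Finset.prod_ne_zero_iff]
  rintro ⟨p, q⟩ h
  simp only [Finset.mem_filter, Finset.mem_univ, true_and] at h
  rw [sub_ne_zero]
  intro he
  have he' : p = q := X_injective he
  rw [he'] at h
  exact lt_irrefl _ h.2

theorem youngVector_rowMonomial_ne_zero (T : Tableau lam n) :
    youngVector (permRep n) rowMonomial T ≠ 0 := by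
  rw [youngVector_rowMonomial]
  exact smul_ne_zero T.card_rowPerms_ne_zero T.spechtPoly_ne_zero

theorem spechtModule_toSubmodule :
    (spechtModule lam n).toSubmodule =
      Submodule.span ℂ (Set.range (youngVector (lam := lam) (permRep n) rowMonomial)) := by
  change Submodule.span ℂ _ = _
  apply le_antisymm <;> rw [Submodule.span_le] <;> rintro _ ⟨T, rfl⟩
  · have h1 : (T.rowPerms.card : ℂ) • spechtPoly T ∈
        Submodule.span ℂ (Set.range (youngVector (lam := lam) (permRep n) rowMonomial)) := by
      rw [← youngVector_rowMonomial]
      exact Submodule.subset_span ⟨T, rfl⟩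
    exact (Submodule.smul_mem_iff _ T.card_rowPerms_ne_zero).mp h1
  · rw [SetLike.mem_coe, youngVector_rowMonomial]
    exact Submodule.smul_mem _ _ (Submodule.subset_span ⟨T, rfl⟩)

end Tableau

/-! ### Rearrangement inside blocks -/

section Rearrangement

theorem exists_sub_lt {ι : Type*} [Finite ι] (f : ι → ℤ) : ∃ K, 0 < K ∧ ∀ p q, f p - f q < K := by
  obtain ⟨B, hB⟩ := (Set.finite_range fun x : ι × ι => f x.1 - f x.2).bddAbove
  refine ⟨max B 0 + 1, by positivity, fun p q => ?_⟩
  have := hB ⟨(p, q), rfl⟩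
  simp only at this
  omega

theorem add_mul_lt_add_mul_of_sub_lt {a b c d K : ℤ} (hK : 0 < K) (h : a - b < K) (hcd : c < d) :
    a + K * c < b + K * d := by
  nlinarith [mul_le_mul_of_nonneg_left (Int.add_one_le_iff.mpr hcd) hK.le]

variable {ι : Type*} [Fintype ι] [DecidableEq ι]

/-- Adding Kc with K large to both r and g turns the order inside blocks into a global one. Since c
is τ-invariant, the difference of the two sums is unchanged, and the usual inequality applies. -/
theorem sum_mul_comp_perm_le_of_blocks {c r g : ι → ℤ} {τ : Equiv.Perm ι}
    (hτ : ∀ i, c (τ i) = c i) (hinj : ∀ p q, c p = c q → r p = r q → p = q)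
    (hg : ∀ p q, c p = c q → r p < r q → g p < g q) :
    ∑ i, r i * g (τ i) ≤ ∑ i, r i * g i ∧
      (∑ i, r i * g (τ i) = ∑ i, r i * g i → τ = 1) := by
  obtain ⟨K₁, hK₁, hr⟩ := exists_sub_lt r
  obtain ⟨K₂, hK₂, hg'⟩ := exists_sub_lt g
  set K := max K₁ K₂
  have hK : 0 < K := lt_max_of_lt_left hK₁
  set L : ι → ℤ := fun i => r i + K * c i with hL
  set G : ι → ℤ := fun i => g i + K * c i with hG
  have hLlt : ∀ p q, c p < c q → L p < L q := fun p q h =>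
    add_mul_lt_add_mul_of_sub_lt hK ((hr p q).trans_le (le_max_left _ _)) h
  have hGlt : ∀ p q, c p < c q → G p < G q := fun p q h =>
    add_mul_lt_add_mul_of_sub_lt hK ((hg' p q).trans_le (le_max_right _ _)) h
  have hLG : ∀ p q, L p < L q → G p < G q := by
    intro p q h
    rcases lt_trichotomy (c p) (c q) with h1 | h1 | h1
    · exact hGlt p q h1
    · have h2 : r p < r q := by simpa [hL, h1] using h
      simpa [hG, h1] using hg p q h1 h2
    · exact absurd (hLlt q p h1) (not_lt.mpr h.le)
  have hmono : Monovary L G := fun p q h => by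
    by_contra! h1
    exact absurd (hLG q p h1) (not_lt.mpr h.le)
  have hcg : ∑ i, c i * g (τ i) = ∑ i, c i * g i := by
    rw [← Equiv.sum_comp τ fun i => c i * g i]
    exact Finset.sum_congr rfl fun i _ => by rw [hτ]
  have h1 : ∑ i, L i * G (τ i) - ∑ i, L i * G i = ∑ i, r i * g (τ i) - ∑ i, r i * g i := by
    have h2 : ∀ i, L i * G (τ i) - L i * G i =
        (r i * g (τ i) - r i * g i) + K * (c i * g (τ i) - c i * g i) := fun i => by
      simp only [hL, hG, hτ]; ring
    rw [← Finset.sum_sub_distrib, Finset.sum_congr rfl fun i _ => h2 i, Finset.sum_add_distrib,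
      ← Finset.mul_sum, Finset.sum_sub_distrib, Finset.sum_sub_distrib, hcg, sub_self, mul_zero,
      add_zero]
  refine ⟨?_, fun heq => ?_⟩
  · have := hmono.sum_mul_comp_perm_le_sum_mul (σ := τ)
    linarith
  · have h2 : Monovary L (G ∘ τ) :=
      (hmono.sum_mul_comp_perm_eq_sum_mul_iff (σ := τ)).mp (by linarith)
    have h3 := comp_perm_eq_self_of_monovaryOn (s := Finset.univ) (σ := τ) (g := L)
      (fun i hi => absurd (Finset.mem_univ i) hi) fun p _ q _ h => h2 (hLG _ _ h)
    ext i
    have h4 := h3 i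
    simp only [hL, hτ, add_left_inj] at h4
    exact hinj _ _ (hτ i) h4

/-- Within each row, f and g are weakly increasing rearrangements of each other; the term K·r keeps
the rows apart. -/
theorem eq_of_comp_perm_of_blocks {c r f g : ι → ℤ} {σ : Equiv.Perm ι}
    (hσ : ∀ i, r (σ i) = r i) (hinj : ∀ p q, r p = r q → c p = c q → p = q)
    (hf : ∀ p q, r p = r q → c p < c q → f p ≤ f q)
    (hg : ∀ p q, r p = r q → c p < c q → g p ≤ g q) (h : ∀ i, f i = g (σ i)) : f = g := by
  obtain ⟨K, hK, hgK⟩ := exists_sub_lt g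
  have h1 := comp_perm_eq_self_of_monovaryOn (s := Finset.univ) (σ := σ)
    (g := fun i => g i + K * r i) (fun i hi => absurd (Finset.mem_univ i) hi) (by
      intro p _ q _ hpq
      simp only [Function.comp_apply, hσ, ← h] at hpq
      rcases lt_trichotomy (r p) (r q) with h1 | h1 | h1
      · exact (add_mul_lt_add_mul_of_sub_lt hK (hgK p q) h1).le
      · have h2 : f p < f q := by simpa [h1] using hpq
        have h3 : g p ≤ g q := by
          rcases lt_trichotomy (c p) (c q) with h4 | h4 | h4
          · exact hg p q h1 h4
          · rw [hinj p q h1 h4]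
          · exact absurd (hf q p h1.symm h4) (not_le.mpr h2)
        simpa [h1] using h3
      · have h2 : f q - f p < K := by rw [h, h]; exact hgK _ _
        exact absurd (add_mul_lt_add_mul_of_sub_lt hK h2 h1) (not_lt.mpr hpq.le))
  ext i
  have h2 := h1 i
  simp only [hσ, add_left_inj] at h2
  rw [h, h2]

end Rearrangement

/-! ### Monomials encoded by integer labels -/

section LabelMonomial

variable {n : ℕ}

/-- The exponent vector with `x`-part `e⁺` and `y`-part `e⁻`. -/
def labelExponent (e : Fin n → ℤ) : Fin n ⊕ Fin n →₀ ℕ :=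
  Finsupp.equivFunOnFinite.symm (Sum.elim (fun i => (e i).toNat) fun i => (-e i).toNat)

theorem labelExponent_injective : Function.Injective (labelExponent (n := n)) := by
  intro e f h
  ext i
  have h1 := DFunLike.congr_fun h (Sum.inl i)
  have h2 := DFunLike.congr_fun h (Sum.inr i)
  simp only [labelExponent, Finsupp.equivFunOnFinite_symm_apply_apply, Sum.elim_inl,
    Sum.elim_inr] at h1 h2
  omega

/-- The monomial `∏ x_i ^ (e i)⁺ y_i ^ (e i)⁻`. -/
def labelMonomial (e : Fin n → ℤ) : PolyXY n := monomial (labelExponent e) 1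

theorem labelMonomial_eq_prod (e : Fin n → ℤ) :
    labelMonomial e =
      ∏ i, X (Sum.inl i) ^ (e i).toNat * X (Sum.inr i) ^ (-e i).toNat := by
  rw [labelMonomial, monomial_eq, Finsupp.prod_fintype _ _ fun _ => pow_zero _,
    Fintype.prod_sum_type, Finset.prod_mul_distrib]
  simp [labelExponent]

theorem diagonalRep_labelMonomial (π : Equiv.Perm (Fin n)) (e : Fin n → ℤ) :
    diagonalRep n π (labelMonomial e) = labelMonomial fun i => e (π⁻¹ i) := by
  change rename (Sum.map π π) (labelMonomial e) = _
  rw [labelMonomial_eq_prod, labelMonomial_eq_prod, map_prod,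
    ← Equiv.prod_comp π fun i => X (Sum.inl i) ^ (e (π⁻¹ i)).toNat *
      X (Sum.inr i) ^ (-e (π⁻¹ i)).toNat]
  simp

theorem coeff_labelMonomial (e g : Fin n → ℤ) :
    coeff (labelExponent g) (labelMonomial e) = if e = g then 1 else 0 := by
  classical
  rw [labelMonomial, coeff_monomial]
  simp [labelExponent_injective.eq_iff]

end LabelMonomial

/-! ### Semistandard labels and triangularity -/

namespace Tableau

open Equiv

variable {lam : YoungDiagram} {n : ℕ}

/-- Labels of the letters of `T` that form a semistandard filling. -/
def IsSemistandardLabel (T : Tableau lam n) (f : Fin n → ℤ) : Prop :=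
  (∀ p q, T.row p = T.row q → T.col p < T.col q → f p ≤ f q) ∧
    ∀ p q, T.col p = T.col q → T.row p < T.row q → f p < f q

theorem coeff_youngIdempotent_labelMonomial (T : Tableau lam n) (f g : Fin n → ℤ) :
    coeff (labelExponent g) ((diagonalRep n).asAlgebraHom T.youngIdempotent (labelMonomial f)) =
      ∑ τ ∈ T.columnPerms, ∑ σ ∈ T.rowPerms,
        if (∀ i, f i = g (τ (σ i))) then signChar (Fin n) τ else 0 := by
  rw [youngIdempotent, map_sum, LinearMap.sum_apply, coeff_sum]
  refine Finset.sum_congr rfl fun τ _ => ?_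
  rw [map_sum, LinearMap.sum_apply, coeff_sum]
  refine Finset.sum_congr rfl fun σ _ => ?_
  rw [Representation.asAlgebraHom_single, LinearMap.smul_apply, diagonalRep_labelMonomial,
    coeff_smul, coeff_labelMonomial, signChar_apply]
  have : ((fun i => f ((τ * σ)⁻¹ i)) = g) ↔ ∀ i, f i = g (τ (σ i)) := by
    constructor
    · rintro rfl i
      simp
    · intro h
      ext i
      rw [h]
      simp
  simp only [this, smul_eq_mul, mul_ite, mul_one, mul_zero]

/-- The row permutation σ leaves ∑ row·label unchanged, and τ can only lower it because g increases
up columns. Equality forces τ = 1, and then sorting along rows gives f = g. -/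
theorem IsSemistandardLabel.sum_le {T : Tableau lam n} {f g : Fin n → ℤ}
    (hf : T.IsSemistandardLabel f) (hg : T.IsSemistandardLabel g) {τ σ : Perm (Fin n)}
    (hτ : τ ∈ T.columnPerms) (hσ : σ ∈ T.rowPerms) (h : ∀ i, f i = g (τ (σ i))) :
    ∑ i, (T.row i : ℤ) * f i ≤ ∑ i, (T.row i : ℤ) * g i ∧
      (∑ i, (T.row i : ℤ) * f i = ∑ i, (T.row i : ℤ) * g i → τ = 1 ∧ f = g) := by
  have h1 : ∑ i, (T.row i : ℤ) * f i = ∑ i, (T.row i : ℤ) * g (τ i) := by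
    rw [← Equiv.sum_comp σ fun i => (T.row i : ℤ) * g (τ i)]
    exact Finset.sum_congr rfl fun i _ => by rw [h, mem_rowPerms.mp hσ]
  have h2 := sum_mul_comp_perm_le_of_blocks (c := fun i => (T.col i : ℤ))
    (r := fun i => (T.row i : ℤ)) (g := g) (τ := τ)
    (fun i => by rw [mem_columnPerms.mp hτ])
    (fun p q hc hr => eq_of_row_col (by exact_mod_cast hr) (by exact_mod_cast hc))
    (fun p q hc hr => hg.2 p q (by exact_mod_cast hc) (by exact_mod_cast hr))
  rw [h1]
  refine ⟨h2.1, fun heq => ?_⟩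
  have h3 := h2.2 heq
  refine ⟨h3, ?_⟩
  subst h3
  exact eq_of_comp_perm_of_blocks (c := fun i => (T.col i : ℤ))
    (r := fun i => (T.row i : ℤ)) (σ := σ)
    (fun i => by rw [mem_rowPerms.mp hσ])
    (fun p q hr hc => eq_of_row_col (by exact_mod_cast hr) (by exact_mod_cast hc))
    (fun p q hr hc => hf.1 p q (by exact_mod_cast hr) (by exact_mod_cast hc))
    (fun p q hr hc => hg.1 p q (by exact_mod_cast hr) (by exact_mod_cast hc)) h

theorem exists_of_coeff_ne_zero {T : Tableau lam n} {f g : Fin n → ℤ}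
    (h : coeff (labelExponent g)
      ((diagonalRep n).asAlgebraHom T.youngIdempotent (labelMonomial f)) ≠ 0) :
    ∃ τ ∈ T.columnPerms, ∃ σ ∈ T.rowPerms, ∀ i, f i = g (τ (σ i)) := by
  rw [coeff_youngIdempotent_labelMonomial] at h
  obtain ⟨τ, hτ, h1⟩ := Finset.exists_ne_zero_of_sum_ne_zero h
  obtain ⟨σ, hσ, h2⟩ := Finset.exists_ne_zero_of_sum_ne_zero h1
  exact ⟨τ, hτ, σ, hσ, by by_contra h3; exact h2 (if_neg h3)⟩

/-- Only τ = 1 contributes, so nothing cancels: the coefficient counts the row permutations fixing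
f. -/
theorem IsSemistandardLabel.coeff_self_ne_zero {T : Tableau lam n} {f : Fin n → ℤ}
    (hf : T.IsSemistandardLabel f) :
    coeff (labelExponent f)
      ((diagonalRep n).asAlgebraHom T.youngIdempotent (labelMonomial f)) ≠ 0 := by
  rw [coeff_youngIdempotent_labelMonomial, Finset.sum_eq_single (1 : Perm (Fin n)),
    ← Finset.sum_filter, map_one, Finset.sum_const, nsmul_eq_mul, mul_one, Nat.cast_ne_zero]
  · exact Finset.card_ne_zero.mpr ⟨1, Finset.mem_filter.mpr
      ⟨mem_rowPerms.mpr fun _ => rfl, fun _ => rfl⟩⟩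
  · intro τ hτ hne
    refine Finset.sum_eq_zero fun σ hσ => if_neg fun h => hne ?_
    exact ((hf.sum_le hf hτ hσ h).2 rfl).1
  · intro h
    exact absurd (mem_columnPerms.mpr fun _ => rfl) h

/-- Each of the two leading monomials occurs in the other polynomial, so the weights agree and the
equality case applies. -/
theorem IsSemistandardLabel.eq_of_eq_smul {T : Tableau lam n} {f g : Fin n → ℤ}
    (hf : T.IsSemistandardLabel f) (hg : T.IsSemistandardLabel g) {c : ℂ}
    (h : (diagonalRep n).asAlgebraHom T.youngIdempotent (labelMonomial f) =
      c • (diagonalRep n).asAlgebraHom T.youngIdempotent (labelMonomial g)) : f = g := by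
  have h1 := hf.coeff_self_ne_zero
  rw [h, coeff_smul, smul_eq_mul] at h1
  have h2 : coeff (labelExponent g)
      ((diagonalRep n).asAlgebraHom T.youngIdempotent (labelMonomial f)) ≠ 0 := by
    rw [h, coeff_smul, smul_eq_mul]
    exact mul_ne_zero (left_ne_zero_of_mul h1) hg.coeff_self_ne_zero
  obtain ⟨τ, hτ, σ, hσ, h3⟩ := exists_of_coeff_ne_zero h2
  obtain ⟨τ', hτ', σ', hσ', h4⟩ := exists_of_coeff_ne_zero (right_ne_zero_of_mul h1)
  have h5 := hf.sum_le hg hτ hσ h3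
  exact (h5.2 (le_antisymm h5.1 (hg.sum_le hf hτ' hσ' h4).1)).2

end Tableau

/-! ### Cocharge labels and recovery of the standard tableau -/

namespace Tableau

open Equiv

variable {lam rho : YoungDiagram} {n : ℕ}

/-- The cocharge label of the letter `i` of `S`, shifted so that the letter `m` has label `0`. -/
def shiftedCocharge (S : Tableau lam n) (m i : ℕ) : ℤ :=
  S.cochargeUp m (i - m) - S.cochargeDown m (m - i)

theorem toNat_shiftedCocharge (S : Tableau lam n) (m i : ℕ) :
    (S.shiftedCocharge m i).toNat = S.cochargeUp m (i - m) := by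
  unfold shiftedCocharge
  rcases le_total m i with h | h
  · rw [Nat.sub_eq_zero_of_le h, cochargeDown]; simp
  · rw [Nat.sub_eq_zero_of_le h, cochargeUp]; simp

theorem toNat_neg_shiftedCocharge (S : Tableau lam n) (m i : ℕ) :
    (-S.shiftedCocharge m i).toNat = S.cochargeDown m (m - i) := by
  unfold shiftedCocharge
  rcases le_total m i with h | h
  · rw [Nat.sub_eq_zero_of_le h, cochargeDown]; simp
  · rw [Nat.sub_eq_zero_of_le h, cochargeUp]; simp

open Classical in
-- Both fillings use the same ascent rule, so they glue at m; changing m only shifts the labels by a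
-- constant.
theorem shiftedCocharge_succ (S : Tableau lam n) (m i : ℕ) :
    S.shiftedCocharge m (i + 1) =
      S.shiftedCocharge m i + if S.Precedes (i + 1) i then 1 else 0 := by
  unfold shiftedCocharge
  rcases le_or_gt m i with h | h
  · obtain ⟨t, rfl⟩ := Nat.exists_eq_add_of_le h
    have h1 : m + t + 1 - m = t + 1 := by omega
    have h2 : m - (m + t + 1) = 0 := by omega
    have h3 : m - (m + t) = 0 := by omega
    rw [h1, h2, h3, Nat.add_sub_cancel_left, cochargeUp]
    push_cast
    ring
  · obtain ⟨t, rfl⟩ := Nat.exists_eq_add_of_lt h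
    have h1 : i + 1 - (i + t + 1) = 0 := by omega
    have h2 : i + t + 1 - (i + 1) = t := by omega
    have h3 : i + t + 1 - i = t + 1 := by omega
    have h4 : i - (i + t + 1) = 0 := by omega
    have h5 : i + t + 1 - t = i + 1 := by omega
    have h6 : i + t + 1 - (t + 1) = i := by omega
    rw [h1, h2, h3, h4, cochargeDown, h5, h6]
    push_cast
    ring

theorem shiftedCocharge_mono (S : Tableau lam n) (m : ℕ) : Monotone (S.shiftedCocharge m) :=
  monotone_nat_of_le_succ fun i => by
    rw [shiftedCocharge_succ]
    split_ifs <;> omega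

theorem precedes_trans {S : Tableau lam n} {a b c : ℕ} (h1 : S.Precedes a b)
    (h2 : S.Precedes b c) : S.Precedes a c := by
  obtain ⟨ha, hb, h1⟩ := h1
  obtain ⟨_, hc, h2⟩ := h2
  exact ⟨ha, hc, by omega⟩

theorem precedes_of_not_precedes {S : Tableau lam n} {a b : ℕ} (ha : a < n) (hb : b < n)
    (hab : a ≠ b) (h : ¬ S.Precedes b a) : S.Precedes a b := by
  simp only [Precedes, not_exists] at h
  have h1 := h hb ha
  refine ⟨ha, hb, ?_⟩
  have h2 : ¬ (S.row ⟨a, ha⟩ = S.row ⟨b, hb⟩ ∧ S.col ⟨a, ha⟩ = S.col ⟨b, hb⟩) := fun h3 =>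
    hab (Fin.mk.inj_iff.mp (eq_of_row_col h3.1 h3.2))
  omega

/-- A constant label between a and b means that no letter in between stands left of its predecessor;
transitivity does the rest. -/
theorem precedes_of_shiftedCocharge_eq (S : Tableau lam n) (m : ℕ) {a b : ℕ} (hab : a < b)
    (hb : b < n) (h : S.shiftedCocharge m a = S.shiftedCocharge m b) : S.Precedes a b := by
  induction b, hab using Nat.le_induction with
  | base =>
    rw [shiftedCocharge_succ] at h
    refine precedes_of_not_precedes (by omega) hb (by omega) fun h1 => ?_
    rw [if_pos h1] at h
    omega
  | succ b hab ih =>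
    have h1 := S.shiftedCocharge_mono m (Nat.le_of_succ_le hab)
    have h2 := S.shiftedCocharge_mono m (Nat.le_succ b)
    refine precedes_trans (ih (by omega) (by simp only [Nat.succ_eq_add_one] at h2; omega)) ?_
    refine precedes_of_not_precedes (by omega) hb (by omega) fun h3 => ?_
    rw [Nat.succ_eq_add_one, shiftedCocharge_succ, if_pos h3] at h2
    rw [shiftedCocharge_succ, if_pos h3] at h
    omega

theorem precedes_iff (S : Tableau lam n) (b c : {b : ℕ × ℕ // b ∈ lam.cells}) :
    S.Precedes (S b) (S c) ↔ c.1.1 < b.1.1 ∨ (b.1.1 = c.1.1 ∧ b.1.2 < c.1.2) := by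
  simp [Precedes, row, col]

/-- If the tableaux ordered two cells oppositely, monotonicity would make their labels equal, and
each cell would precede the other in reading order, which depends on cells alone. So S₂ ∘ S₁⁻¹ is an
increasing bijection of `Fin n`, hence the identity. -/
theorem eq_of_shiftedCocharge_eq {S₁ S₂ : Tableau lam n} {m : ℕ}
    (h : ∀ b, S₁.shiftedCocharge m (S₁ b) = S₂.shiftedCocharge m (S₂ b)) : S₁ = S₂ := by
  have h1 : ∀ b c, S₁ b < S₁ c → S₂ b < S₂ c := by
    intro b c hbc
    by_contra! hle
    have hlt : S₂ c < S₂ b := lt_of_le_of_ne hle fun he => by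
      rw [S₂.injective he] at hbc
      exact lt_irrefl _ hbc
    have h2 := S₁.shiftedCocharge_mono m (Fin.le_def.mp hbc.le)
    have h3 := S₂.shiftedCocharge_mono m (Fin.le_def.mp hlt.le)
    rw [← h, ← h] at h3
    have h4 := S₁.precedes_of_shiftedCocharge_eq m (Fin.lt_def.mp hbc) (S₁ c).2 (le_antisymm h2 h3)
    have h5 := S₂.precedes_of_shiftedCocharge_eq m (Fin.lt_def.mp hlt) (S₂ b).2
      (by rw [← h, ← h]; exact le_antisymm h3 h2)
    rw [precedes_iff] at h4 h5
    omega
  have h2 : StrictMono (S₁.symm.trans S₂) := fun p q hpq => by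
    simpa using h1 (S₁.symm p) (S₁.symm q) (by simpa using hpq)
  have h3 := (h2.range_inj (strictMono_id (α := Fin n))).mp (by simp [EquivLike.range_eq_univ])
  ext b
  have h4 := congrFun h3 (S₁ b)
  simp only [Equiv.trans_apply, Equiv.symm_apply_apply, id_eq] at h4
  rw [h4]

/-- The labels `ccTab - ccTab'` of `S`, carried by the letters of `T`. -/
def letterLabel (k : ℕ) (S T : Tableau lam n) (i : Fin n) : ℤ :=
  S.shiftedCocharge (n - k) (S (T.symm i))

theorem muMonomial_eq_labelMonomial (k : ℕ) (S T : Tableau lam n) :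
    muMonomial k S T = labelMonomial (letterLabel k S T) := by
  rw [labelMonomial_eq_prod, muMonomial, ← Equiv.prod_comp T]
  refine Finset.prod_congr rfl fun b _ => ?_
  rw [letterLabel, toNat_shiftedCocharge, toNat_neg_shiftedCocharge, Equiv.symm_apply_apply]
  rfl

theorem diagonalRep_muMonomial (k : ℕ) (S : Tableau lam n) (π : Perm (Fin n))
    (T : Tableau lam n) : diagonalRep n π (muMonomial k S T) = muMonomial k S (permute π T) := by
  rw [muMonomial_eq_labelMonomial, muMonomial_eq_labelMonomial, diagonalRep_labelMonomial]
  rfl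

/-- Equal labels in one column would make the lower cell precede the upper one, but the reading word
runs from top to bottom. -/
theorem isSemistandardLabel_letterLabel (k : ℕ) {S : Tableau lam n} (hS : S.IsStandard)
    (T : Tableau lam n) : T.IsSemistandardLabel (letterLabel k S T) := by
  refine ⟨fun p q hr hc => ?_, fun p q hc hr => ?_⟩
  · exact S.shiftedCocharge_mono _ (Fin.le_def.mp (hS.1 _ _ hr hc).le)
  · have h1 := Fin.lt_def.mp (hS.2 _ _ hc hr)
    refine lt_of_le_of_ne (S.shiftedCocharge_mono _ h1.le) fun he => ?_
    have h2 := S.precedes_of_shiftedCocharge_eq _ h1 (S _).2 he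
    rw [precedes_iff] at h2
    simp only [row, col] at hr hc
    omega

theorem higherSpecht_ne_zero (k : ℕ) {S : Tableau lam n} (hS : S.IsStandard)
    (T : Tableau lam n) : youngVector (diagonalRep n) (muMonomial k S) T ≠ 0 := by
  intro h
  apply (isSemistandardLabel_letterLabel k hS T).coeff_self_ne_zero
  rw [← muMonomial_eq_labelMonomial]
  rw [youngVector] at h
  rw [h, coeff_zero]

theorem higherSpechtSpan_eq (k : ℕ) (S : SYT lam n) :
    higherSpechtSpan k S =
      Submodule.span ℂ (Set.range (youngVector (diagonalRep n) (muMonomial k S.1))) :=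
  span_standard_eq (diagonalRep_muMonomial k S.1)

/-- `M_lam^S` as a subrepresentation. -/
def higherSpechtSubrep (k : ℕ) (S : SYT lam n) : Subrepresentation (diagonalRep n) where
  toSubmodule := higherSpechtSpan k S
  apply_mem_toSubmodule π v hv := by
    rw [higherSpechtSpan_eq, ← range_youngOrbit (diagonalRep_muMonomial k S.1) S.1] at hv ⊢
    obtain ⟨a, rfl⟩ := hv
    exact ⟨_, youngOrbit_single_mul S.1 π a⟩

theorem nonempty_equiv_spechtModule (k : ℕ) (S : SYT lam n) :
    Nonempty (Representation.Equiv (higherSpechtSubrep k S).toRepresentation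
      (spechtModule lam n).toRepresentation) :=
  nonempty_equiv_of_span_youngVector (diagonalRep_muMonomial k S.1) permRep_rowMonomial
    (higherSpecht_ne_zero k S.2 S.1) S.1.youngVector_rowMonomial_ne_zero
    (higherSpechtSpan_eq k S) spechtModule_toSubmodule

theorem sigma_eq_of_mem_spans (k : ℕ) {S₁ : SYT lam n} {S₂ : SYT rho n} {v : PolyXY n}
    (hv : v ≠ 0) (h1 : v ∈ higherSpechtSpan k S₁) (h2 : v ∈ higherSpechtSpan k S₂) :
    (⟨lam, S₁⟩ : Σ nu : YoungDiagram, SYT nu n) = ⟨rho, S₂⟩ := by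
  rw [higherSpechtSpan_eq] at h1 h2
  have hm := diagonalRep_muMonomial k S₁.1
  have hm' := diagonalRep_muMonomial k S₂.1
  obtain rfl := shape_eq_of_mem_spans hm hm' hv h1 h2 (higherSpecht_ne_zero k S₁.2 S₁.1)
    (higherSpecht_ne_zero k S₂.2 S₂.1)
  obtain ⟨c, hc⟩ := exists_youngVector_eq_smul hm hm' hv h1 h2 S₁.1
  simp only [youngVector, muMonomial_eq_labelMonomial] at hc
  have h3 := (isSemistandardLabel_letterLabel k S₁.2 S₁.1).eq_of_eq_smul
    (isSemistandardLabel_letterLabel k S₂.2 S₁.1) hc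
  have h4 : S₁ = S₂ := Subtype.ext (eq_of_shiftedCocharge_eq (m := n - k) fun b => by
    have := congrFun h3 (S₁.1 b)
    simpa only [letterLabel, Equiv.symm_apply_apply] using this)
  rw [h4]

end Tableau

end

theorem proposition4p8 (n k : ℕ) (hk : 1 ≤ k) (hkn : k ≤ n) :
    (∀ (lam : YoungDiagram) (S : SYT lam n),
      ∃ M : Subrepresentation (diagonalRep n),
        M.toSubmodule = higherSpechtSpan k S ∧
        Nonempty (Representation.Equiv M.toRepresentation
          (spechtModule lam n).toRepresentation)) ∧
    (∀ (lam rho : YoungDiagram) (S₁ : SYT lam n) (S₂ : SYT rho n),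
      (⟨lam, S₁⟩ : Σ nu : YoungDiagram, SYT nu n) ≠ ⟨rho, S₂⟩ →
        Disjoint (higherSpechtSpan k S₁) (higherSpechtSpan k S₂)) := by
  refine ⟨fun lam S => ⟨Tableau.higherSpechtSubrep k S, rfl,
    Tableau.nonempty_equiv_spechtModule k S⟩, fun lam rho S₁ S₂ hne => ?_⟩
  rw [Submodule.disjoint_def]
  intro v h1 h2
  by_contra hv
  exact hne (Tableau.sigma_eq_of_mem_spans k hv h1 h2)
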